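/- Let $p$ be a prime, $k$ a field of characteristic $p$, $G$ a finite group and $H\le G$ a subgroup whose index is prime to $p$. Definitions. For a finite group $G$ let $kG\text{-stab}$ be the stable category of finitely generated $kG$-modules (the quotient of $kG\text{-mod}$ that identifies two maps when their difference factors through a projective module), with $\otimes=\otimes_k$. Let $T(G)$ be the group of isomorphism classes of $\otimes$-invertible objects of $kG\text{-stab}$ (the group of endotrivial modules), and $T(G,H)=\ker(\mathrm{Res}:T(G)\to T(H))$. For a finite $G$-set $X$ let $\mathrm{Rep}(X)$ be the category of functors from the action groupoid $G\ltimes X$ (objects $x\in X$, arrows $x\to gx$) to $k$-vector spaces, and let $\mathrm{StRep}(X)$ be its quotient by the maps that factor through a projective object. A $G$-map $\alpha:Y\to X$ gives $\alpha^*:\mathrm{StRep}(X)\to\mathrm{StRep}(Y)$. Let $\mathbb 1\in\mathrm{StRep}(X)$ be the constant representation $k$, and let $\mathbb G_m(X)=\mathrm{Aut}_{\mathrm{StRep}(X)}(\mathbb 1)$, a presheaf of abelian groups on finite $G$-sets. For an abelian group $A$, the constant sipp sheaf $\underline A$ is $\underline A(X)=A^{\overline X}$, where $\overline X$ is the set of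 $G$-orbits $Gx$ of $X$ with $p$ dividing $|\mathrm{St}_G(x)|$. A map $\alpha:U\to X$ of finite $G$-sets is a sipp-cover if every $x\in X$ has a preimage $u\in U$ with $[\mathrm{St}_G(x):\mathrm{St}_G(u)]$ prime to $p$. For $\mathcal U=\{U\to X\}$ and a presheaf $P$ of abelian groups, $\check H^n(\mathcal U,P)$ is the $n$-th cohomology of the Čech complex with $P(U^{(n+1)})$ in degree $n$, where $U^{(n)}=U\times_X\cdots\times_XU$ ($n$ factors), and with the alternating sum of the maps induced by the projections that omit one factor as differential. Theorem. The map $G/H\to G/G$ is a sipp-cover; put $\mathcal U=\{G/H\to G/G\}$. (i) $\mathbb G_m$ is the constant sipp sheaf $\underline{k^\times}$: there is an isomorphism of presheaves $\underline{k^\times}\cong\mathbb G_m$ that sends $c:\overline X\to k^\times$ to the stable class of any automorphism of the constant representation $k$ on $X$ that acts at $x$ as multiplication by $c(Gx)$ for all $x$ with $p\mid|\mathrm{St}_G(x)|$. (ii) There is a canonical isomorphism of groups $\Phi:T(G,H)\cong\check H^1(\mathcal U,\mathbb G_m)$. Explicitly, write $V$ also for the representation of a $G$-set with value $V$ at every point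 that a $kG$-module $V$ defines. If the class of $V$ lies in $T(G,H)$, then there are isomorphisms $f:V\to\mathbb 1$ in $\mathrm{StRep}(G/H)$; for each of them, $\mathrm{pr}_1^*(f)\circ\mathrm{pr}_2^*(f)^{-1}\in\mathbb G_m((G/H)^{(2)})$ is a Čech $1$-cocycle, and its class is $\Phi([V])$. The group isomorphism $\Phi$ is uniquely determined by this property. -/

import Mathlib

open CategoryTheory Limits MonoidalCategory Opposite

universe u v w

namespace SippCech

section Trace

/-- The identity of `P` is a trace of a family of (not necessarily equivariant) endomorphisms.
For representations of finite groupoids over a field, this characterizes projectivity. -/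
def IsTraceSplit {J A : Type*} [Category* J] [IsGroupoid J] [Category* A] [Preadditive A]
    [∀ x : J, Finite (Σ y : J, y ⟶ x)] (P : J ⥤ A) : Prop :=
  ∃ θ : ∀ x, P.obj x ⟶ P.obj x, ∀ x,
    letI := Fintype.ofFinite (Σ y : J, y ⟶ x)
    ∑ a : (Σ y : J, y ⟶ x), P.map (inv a.2) ≫ θ a.1 ≫ P.map a.2 = 𝟙 (P.obj x)

variable {J J' A : Type*} [Category* J] [IsGroupoid J] [Category* J'] [IsGroupoid J']
  [Category* A] [Preadditive A]
  [∀ x : J, Finite (Σ y : J, y ⟶ x)] [∀ x : J', Finite (Σ y : J', y ⟶ x)]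

/-- The direct sum of all `P y` over all arrows `y ⟶ x`. -/
noncomputable abbrev freeObj [HasFiniteBiproducts A] (P : J ⥤ A) (x : J) : A :=
  ⨁ fun a : (Σ y : J, y ⟶ x) => P.obj a.1

/-- The inclusion of the summand of `freeObj P x` indexed by an arrow. -/
noncomputable def freeι [HasFiniteBiproducts A] (P : J ⥤ A) {y x : J} (f : y ⟶ x) :
    P.obj y ⟶ freeObj P x :=
  biproduct.ι (fun a : (Σ y : J, y ⟶ x) => P.obj a.1) ⟨y, f⟩

/-- Functoriality of `freeObj`: an arrow `h` permutes the summands by composition with `h`. -/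
noncomputable def freeMap [HasFiniteBiproducts A] (P : J ⥤ A) {x x' : J} (h : x ⟶ x') :
    freeObj P x ⟶ freeObj P x' :=
  biproduct.desc fun a => freeι P (a.2 ≫ h)

theorem freeι_map [HasFiniteBiproducts A] (P : J ⥤ A) {y x x' : J} (f : y ⟶ x) (h : x ⟶ x') :
    freeι P f ≫ freeMap P h = freeι P (f ≫ h) :=
  biproduct.ι_desc _ _

theorem freeObj_hom_ext [HasFiniteBiproducts A] (P : J ⥤ A) {x : J} {B : A}
    {u v : freeObj P x ⟶ B} (h : ∀ (y : J) (f : y ⟶ x), freeι P f ≫ u = freeι P f ≫ v) : u = v :=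
  biproduct.hom_ext' _ _ fun a => h a.1 a.2

/-- The free representation on the underlying family of objects of `P`. -/
noncomputable def freeCover [HasFiniteBiproducts A] (P : J ⥤ A) : J ⥤ A where
  obj x := freeObj P x
  map h := freeMap P h
  map_id x := freeObj_hom_ext P fun y f => by
    rw [freeι_map, Category.comp_id, Category.comp_id]
  map_comp f g := freeObj_hom_ext P fun y h => by
    rw [← Category.assoc, freeι_map, freeι_map, freeι_map, Category.assoc]

/-- The map `freeObj P x ⟶ P x` given by the action of arrows. -/
noncomputable def freeDesc [HasFiniteBiproducts A] (P : J ⥤ A) (x : J) :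
    freeObj P x ⟶ P.obj x :=
  biproduct.desc fun a => P.map a.2

theorem freeι_desc [HasFiniteBiproducts A] (P : J ⥤ A) {y x : J} (f : y ⟶ x) :
    freeι P f ≫ freeDesc P x = P.map f :=
  biproduct.ι_desc _ _

/-- The canonical epimorphism from the free representation. -/
noncomputable def freeCoverπ [HasFiniteBiproducts A] (P : J ⥤ A) : freeCover P ⟶ P where
  app x := freeDesc P x
  naturality x y h := freeObj_hom_ext P fun z f => by
    change freeι P f ≫ freeMap P h ≫ freeDesc P y = freeι P f ≫ freeDesc P x ≫ P.map h
    rw [← Category.assoc, freeι_map, freeι_desc, ← Category.assoc, freeι_desc, P.map_comp]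

theorem isTraceSplit_of_projective [HasFiniteBiproducts A] (P : J ⥤ A) [Projective P] :
    IsTraceSplit P := by
  classical
  have hepi : Epi (freeCoverπ P) := by
    have : ∀ x, Epi ((freeCoverπ P).app x) := fun x => by
      have h : freeι P (𝟙 x) ≫ (freeCoverπ P).app x = 𝟙 _ :=
        (freeι_desc P (𝟙 x)).trans (P.map_id x)
      have : Epi (freeι P (𝟙 x) ≫ (freeCoverπ P).app x) := by rw [h]; infer_instance
      exact epi_of_epi (freeι P (𝟙 x)) _
    exact NatTrans.epi_of_epi_app _
  let s : ∀ x, P.obj x ⟶ freeObj P x :=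
    fun x => (Projective.factorThru (𝟙 P) (freeCoverπ P)).app x
  have hs : ∀ x, s x ≫ freeDesc P x = 𝟙 (P.obj x) := fun x =>
    congrArg (fun t => NatTrans.app t x) (Projective.factorThru_comp (𝟙 P) (freeCoverπ P))
  have hn : ∀ {x y : J} (h : x ⟶ y), P.map h ≫ s y = s x ≫ freeMap P h := fun h =>
    (Projective.factorThru (𝟙 P) (freeCoverπ P)).naturality h
  let q : ∀ (x : J) (a : Σ y : J, y ⟶ x), freeObj P x ⟶ P.obj a.1 :=
    fun x a => biproduct.π (fun a : (Σ y : J, y ⟶ x) => P.obj a.1) a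
  refine ⟨fun x => s x ≫ q x ⟨x, 𝟙 x⟩, fun x => ?_⟩
  let _ := Fintype.ofFinite (Σ y : J, y ⟶ x)
  have key : ∀ a : (Σ y : J, y ⟶ x), freeMap P (inv a.2) ≫ q a.1 ⟨a.1, 𝟙 a.1⟩ = q x a := by
    rintro ⟨y, f⟩
    refine freeObj_hom_ext P fun z g => ?_
    rw [← Category.assoc, freeι_map]
    by_cases hzy : (⟨z, g⟩ : Σ y : J, y ⟶ x) = ⟨y, f⟩
    · cases hzy
      rw [IsIso.hom_inv_id]
      exact (biproduct.ι_π_self (fun a : (Σ z : J, z ⟶ y) => P.obj a.1) ⟨y, 𝟙 y⟩).trans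
        (biproduct.ι_π_self (fun a : (Σ z : J, z ⟶ x) => P.obj a.1) ⟨y, f⟩).symm
    · have : (⟨z, g ≫ inv f⟩ : Σ z : J, z ⟶ y) ≠ ⟨y, 𝟙 y⟩ := by
        intro h
        apply hzy
        obtain ⟨rfl, h2⟩ := Sigma.mk.inj_iff.mp h
        have h3 : g ≫ inv f = 𝟙 _ := eq_of_heq h2
        have : g = f := by simpa using congrArg (· ≫ f) h3
        rw [this]
      exact (biproduct.ι_π_ne (fun a : (Σ z : J, z ⟶ y) => P.obj a.1) this).trans
        (biproduct.ι_π_ne (fun a : (Σ z : J, z ⟶ x) => P.obj a.1) hzy).symm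
  have h1 : ∀ a : (Σ y : J, y ⟶ x), P.map (inv a.2) ≫ (s a.1 ≫ q a.1 ⟨a.1, 𝟙 a.1⟩) ≫ P.map a.2 =
      s x ≫ q x a ≫ P.map a.2 := by
    intro a
    rw [← key a, Category.assoc, ← Category.assoc, hn, Category.assoc, Category.assoc]
  rw [Finset.sum_congr rfl fun a _ => h1 a, ← Preadditive.comp_sum]
  refine Eq.trans ?_ (hs x)
  congr 1
  refine freeObj_hom_ext P fun y f => ?_
  rw [freeι_desc, Preadditive.comp_sum, Finset.sum_eq_single ⟨y, f⟩]
  · have h2 : freeι P f ≫ q x ⟨y, f⟩ = 𝟙 _ :=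
      biproduct.ι_π_self (fun a : (Σ z : J, z ⟶ x) => P.obj a.1) ⟨y, f⟩
    rw [← Category.assoc, h2]
    exact Category.id_comp _
  · intro b _ hb
    have h2 : freeι P f ≫ q x b = 0 :=
      biproduct.ι_π_ne (fun a : (Σ z : J, z ⟶ x) => P.obj a.1) hb.symm
    rw [← Category.assoc, h2, zero_comp]
  · exact fun h => (h (Finset.mem_univ _)).elim

theorem projective_of_isTraceSplit [HasPushouts A] (hA : ∀ V : A, Projective V) (P : J ⥤ A)
    (hP : IsTraceSplit P) : Projective P := by
  classical
  obtain ⟨θ, hθ⟩ := hP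
  refine ⟨fun {E B} f e he => ?_⟩
  have he' : ∀ x, Epi (e.app x) := (NatTrans.epi_iff_epi_app e).mp he
  have := hA
  let l : ∀ x, P.obj x ⟶ E.obj x := fun x => Projective.factorThru (f.app x) (e.app x)
  have hl : ∀ x, l x ≫ e.app x = f.app x := fun x => Projective.factorThru_comp _ _
  let _ : ∀ x : J, Fintype (Σ y : J, y ⟶ x) := fun x => Fintype.ofFinite _
  refine ⟨{ app := fun x => ∑ a : (Σ y : J, y ⟶ x),
              P.map (inv a.2) ≫ (θ a.1 ≫ l a.1) ≫ E.map a.2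
            naturality := fun x x' h => ?_ }, ?_⟩
  · let q : (Σ y : J, y ⟶ x) ≃ (Σ y : J, y ⟶ x') :=
      { toFun := fun a => ⟨a.1, a.2 ≫ h⟩
        invFun := fun a => ⟨a.1, a.2 ≫ inv h⟩
        left_inv := fun a => by simp
        right_inv := fun a => by simp }
    rw [← q.sum_comp, Preadditive.comp_sum, Preadditive.sum_comp]
    refine Finset.sum_congr rfl fun a _ => ?_
    simp [q]
  · ext x
    have h1 : ∀ a : (Σ y : J, y ⟶ x), (P.map (inv a.2) ≫ (θ a.1 ≫ l a.1) ≫ E.map a.2) ≫ e.app x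
        = (P.map (inv a.2) ≫ θ a.1 ≫ P.map a.2) ≫ f.app x := by
      intro a
      simp [e.naturality, reassoc_of% hl]
    simp only [NatTrans.comp_app]
    rw [Preadditive.sum_comp, Finset.sum_congr rfl fun a _ => h1 a, ← Preadditive.sum_comp, hθ x,
      Category.id_comp]

theorem IsTraceSplit.comp_faithful (F : J ⥤ J') [F.Faithful] {P : J' ⥤ A} (hP : IsTraceSplit P) :
    IsTraceSplit (F ⋙ P) := by
  classical
  obtain ⟨θ, hθ⟩ := hP
  let E : J → Type _ := fun w => Σ y : J', y ⟶ F.obj w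
  let push : ∀ {w z : J} (_ : w ⟶ z), E w → E z := fun f e => ⟨e.1, e.2 ≫ F.map f⟩
  have push_id : ∀ w (e : E w), push (𝟙 w) e = e := fun w e => by simp [push]
  have push_comp : ∀ {w z t : J} (f : w ⟶ z) (g : z ⟶ t) (e : E w),
      push (f ≫ g) e = push g (push f e) := fun f g e => by simp [push]
  let S : Setoid (Σ w, E w) :=
    { r := fun a b => ∃ f : a.1 ⟶ b.1, push f a.2 = b.2
      iseqv :=
        { refl := fun a => ⟨𝟙 _, push_id _ _⟩
          symm := fun {a b} ⟨f, hf⟩ => ⟨inv f, by rw [← hf, ← push_comp]; simp [push_id]⟩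
          trans := fun {a b c} ⟨f, hf⟩ ⟨g, hg⟩ => ⟨f ≫ g, by rw [push_comp, hf, hg]⟩ } }
  let R : ∀ w, E w → Prop := fun w e => (Quotient.mk S ⟨w, e⟩).out = ⟨w, e⟩
  let _ : ∀ x : J, Fintype (Σ y : J, y ⟶ x) := fun x => Fintype.ofFinite _
  let _ : ∀ x : J', Fintype (Σ y : J', y ⟶ x) := fun x => Fintype.ofFinite _
  let _ : ∀ x : J, Fintype {e : E x // R x e} := fun x => Fintype.ofFinite _
  let c : ∀ (z : J') (a : Σ y : J', y ⟶ z), P.obj z ⟶ P.obj z := fun z a =>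
    P.map (inv a.2) ≫ θ a.1 ≫ P.map a.2
  refine ⟨fun w => ∑ e : {e : E w // R w e}, c _ e.1, fun z => ?_⟩
  let m : (Σ a : (Σ w : J, w ⟶ z), {e : E a.1 // R a.1 e}) → E z := fun b => push b.1.2 b.2.1
  have hm : Function.Bijective m := by
    constructor
    · rintro ⟨⟨w, f⟩, ⟨e, he⟩⟩ ⟨⟨w', f'⟩, ⟨e', he'⟩⟩ h
      change push f e = push f' e' at h
      have h1 : Quotient.mk S ⟨w, e⟩ = Quotient.mk S ⟨w', e'⟩ := by
        apply Quotient.sound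
        exact S.trans (b := ⟨z, push f e⟩) ⟨f, rfl⟩ (S.symm ⟨f', h.symm⟩)
      have h2 : (⟨w, e⟩ : Σ w, E w) = ⟨w', e'⟩ := by rw [← he, ← he', h1]
      cases h2
      have h3 : f = f' := by
        apply F.map_injective
        have := eq_of_heq (Sigma.mk.inj_iff.mp h).2
        simpa using congrArg (inv e.2 ≫ ·) this
      cases h3
      rfl
    · intro e
      let o := (Quotient.mk S ⟨z, e⟩).out
      have ho : Quotient.mk S o = Quotient.mk S ⟨z, e⟩ := Quotient.out_eq _
      obtain ⟨f, hf⟩ : ∃ f : o.1 ⟶ z, push f o.2 = e := Quotient.exact ho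
      refine ⟨⟨⟨o.1, f⟩, ⟨o.2, ?_⟩⟩, hf⟩
      change (Quotient.mk S o).out = o
      rw [ho]
  have h1 : ∀ a : (Σ w : J, w ⟶ z), (F ⋙ P).map (inv a.2) ≫
      (∑ e : {e : E a.1 // R a.1 e}, c _ e.1) ≫ (F ⋙ P).map a.2 =
      ∑ e : {e : E a.1 // R a.1 e}, c _ (m ⟨a, e⟩) := by
    intro a
    rw [Preadditive.sum_comp, Preadditive.comp_sum]
    refine Finset.sum_congr rfl fun e _ => ?_
    simp [c, m, push]
  rw [Finset.sum_congr rfl fun a _ => h1 a]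
  rw [← Fintype.sum_sigma' (fun a e => c _ (m ⟨a, e⟩))]
  have := (Equiv.ofBijective m hm).sum_comp (fun e => c _ e)
  exact this.trans (hθ (F.obj z))

/-- Restriction along a faithful functor between finite groupoids preserves projective
representations. -/
theorem projective_comp_faithful [HasFiniteBiproducts A] [HasPushouts A]
    (hA : ∀ V : A, Projective V) (F : J ⥤ J') [F.Faithful] (P : J' ⥤ A) [Projective P] :
    Projective (F ⋙ P) :=
  projective_of_isTraceSplit hA _ ((isTraceSplit_of_projective P).comp_faithful F)
end Trace

section Stable
variable {C D : Type*} [Category* C] [Category* D] [Preadditive C] [Preadditive D]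

variable (C) in
/-- Two morphisms are stably equal when their difference factors through a projective object. -/
def stableRel : HomRel C := fun X Y f g =>
  ∃ (P : C) (_ : Projective P) (a : X ⟶ P) (b : P ⟶ Y), f - g = a ≫ b

variable (C) in
/-- The stable category: the additive quotient of `C` by its projective objects. -/
abbrev Stab := Quotient (stableRel C)

variable (C) in
/-- The quotient functor to the stable category. -/
abbrev toStab : C ⥤ Stab C := Quotient.functor (stableRel C)

theorem toStab_map_eq (F : C ⥤ D) [F.Additive] [F.PreservesProjectiveObjects] {X Y : C}
    {f g : X ⟶ Y} (h : stableRel C f g) :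
    (toStab D).map (F.map f) = (toStab D).map (F.map g) := by
  obtain ⟨P, hP, a, b, hab⟩ := h
  exact CategoryTheory.Quotient.sound _ ⟨F.obj P, F.projective_obj_of_projective hP, F.map a, F.map b, by
    rw [← F.map_sub, hab, F.map_comp]⟩

/-- An additive functor that preserves projectives induces a functor on stable categories. -/
def stabMap (F : C ⥤ D) [F.Additive] [F.PreservesProjectiveObjects] : Stab C ⥤ Stab D :=
  CategoryTheory.Quotient.lift _ (F ⋙ toStab D) fun _ _ _ _ h => toStab_map_eq F h

section Monoidal
theorem tensorLeft_preservesProjective {C : Type*} [Category* C] [MonoidalCategory C]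
    [RigidCategory C] (X : C) : (tensorLeft X).PreservesProjectiveObjects :=
  have : (tensorLeft (ᘁX)).PreservesEpimorphisms :=
    Functor.preservesEpimorphisms_of_adjunction (tensorLeftAdjunction (ᘁ(ᘁX)) (ᘁX))
  Functor.preservesProjectiveObjects_of_adjunction_of_preservesEpimorphisms
    (tensorLeftAdjunction (ᘁX) X)

theorem tensorRight_preservesProjective {C : Type*} [Category* C] [MonoidalCategory C]
    [RigidCategory C] (X : C) : (tensorRight X).PreservesProjectiveObjects :=
  have : (tensorRight (Xᘁ)).PreservesEpimorphisms :=
    Functor.preservesEpimorphisms_of_adjunction (tensorRightAdjunction (Xᘁ) ((Xᘁ)ᘁ))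
  Functor.preservesProjectiveObjects_of_adjunction_of_preservesEpimorphisms
    (tensorRightAdjunction X (Xᘁ))

variable [MonoidalCategory C] [MonoidalPreadditive C]
  [∀ X : C, (tensorLeft X).PreservesProjectiveObjects]
  [∀ X : C, (tensorRight X).PreservesProjectiveObjects]

/-- The tensor product of the stable category, induced by that of `C`. -/
instance : MonoidalCategoryStruct (Stab C) where
  tensorObj X Y := (toStab C).obj (X.as ⊗ Y.as)
  whiskerLeft X _ _ f := (stabMap (tensorLeft X.as)).map f
  whiskerRight f Y := (stabMap (tensorRight Y.as)).map f
  tensorHom {_ Y₁ X₂ _} f g :=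
    (stabMap (tensorRight X₂.as)).map f ≫ (stabMap (tensorLeft Y₁.as)).map g
  tensorUnit := (toStab C).obj (𝟙_ C)
  associator X Y Z := (toStab C).mapIso (α_ X.as Y.as Z.as)
  leftUnitor X := (toStab C).mapIso (λ_ X.as)
  rightUnitor X := (toStab C).mapIso (ρ_ X.as)

theorem toStab_whiskerLeft (X : C) {Y Z : C} (f : Y ⟶ Z) :
    (toStab C).obj X ◁ (toStab C).map f = (toStab C).map (X ◁ f) := rfl

theorem toStab_whiskerRight {Y Z : C} (f : Y ⟶ Z) (X : C) :
    (toStab C).map f ▷ (toStab C).obj X = (toStab C).map (f ▷ X) := rfl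

theorem toStab_tensorHom {X Y Z T : C} (f : X ⟶ Y) (g : Z ⟶ T) :
    (toStab C).map f ⊗ₘ (toStab C).map g = (toStab C).map (f ⊗ₘ g) :=
  (congrArg (toStab C).map (MonoidalCategory.tensorHom_def f g)).symm

instance : MonoidalCategory (Stab C) where
  tensorHom_def _ _ := rfl
  id_tensorHom_id X Y :=
    (toStab_tensorHom (𝟙 X.as) (𝟙 Y.as)).trans
      (congrArg (toStab C).map (id_tensorHom_id X.as Y.as))
  tensorHom_comp_tensorHom := by
    rintro _ _ _ _ _ _ ⟨f⟩ ⟨g⟩ ⟨h⟩ ⟨k⟩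
    have e := congrArg (toStab C).map (tensorHom_comp_tensorHom f g h k)
    rw [Functor.map_comp, ← toStab_tensorHom, ← toStab_tensorHom, ← toStab_tensorHom] at e
    exact e
  whiskerLeft_id X Y := (stabMap (tensorLeft X.as)).map_id Y
  id_whiskerRight X Y := (stabMap (tensorRight Y.as)).map_id X
  associator_naturality := by
    rintro _ _ _ _ _ _ ⟨f⟩ ⟨g⟩ ⟨h⟩
    have e := congrArg (toStab C).map (associator_naturality f g h)
    rw [Functor.map_comp, Functor.map_comp, ← toStab_tensorHom, ← toStab_tensorHom,
      ← toStab_tensorHom, ← toStab_tensorHom] at e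
    exact e
  leftUnitor_naturality := by
    rintro _ _ ⟨f⟩
    exact congrArg (toStab C).map (leftUnitor_naturality f)
  rightUnitor_naturality := by
    rintro _ _ ⟨f⟩
    exact congrArg (toStab C).map (rightUnitor_naturality f)
  pentagon W X Y Z :=
    congrArg (toStab C).map (pentagon W.as X.as Y.as Z.as)
  triangle X Y := congrArg (toStab C).map (triangle X.as Y.as)

variable [MonoidalCategory D] [MonoidalPreadditive D]
  [∀ X : D, (tensorLeft X).PreservesProjectiveObjects]
  [∀ X : D, (tensorRight X).PreservesProjectiveObjects]

open Functor in
instance (F : C ⥤ D) [F.Additive] [F.PreservesProjectiveObjects] [F.Monoidal] :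
    (stabMap F).Monoidal :=
  CoreMonoidal.toMonoidal
    { εIso := (toStab D).mapIso (Monoidal.εIso F)
      μIso := fun X Y => (toStab D).mapIso (Monoidal.μIso F X.as Y.as)
      μIso_hom_natural_left := by
        rintro X Y ⟨f⟩ Z
        exact congrArg (toStab D).map (LaxMonoidal.μ_natural_left F f Z.as)
      μIso_hom_natural_right := by
        rintro X Y Z ⟨f⟩
        exact congrArg (toStab D).map (LaxMonoidal.μ_natural_right F Z.as f)
      associativity := fun X Y Z =>
        congrArg (toStab D).map (LaxMonoidal.associativity F X.as Y.as Z.as)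
      left_unitality := fun X =>
        congrArg (toStab D).map (LaxMonoidal.left_unitality F X.as)
      right_unitality := fun X =>
        congrArg (toStab D).map (LaxMonoidal.right_unitality F X.as) }

end Monoidal
end Stable


section Endotrivial

theorem projective_fgModuleCat (k : Type u) [Field k] (V : FGModuleCat k) : Projective V where
  factors {E X} f e he := by
    have he' : Epi ((forget₂ (FGModuleCat k) (ModuleCat k)).map e) := inferInstance
    have hs : Function.Surjective e.hom.hom := (ModuleCat.epi_iff_surjective _).mp he'
    obtain ⟨s, hs⟩ := e.hom.hom.exists_rightInverse_of_surjective (LinearMap.range_eq_top.mpr hs)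
    refine ⟨f ≫ FGModuleCat.ofHom s, ?_⟩
    ext x
    exact congrArg (fun t => t (f x)) hs

variable (k : Type u) [Field k] (G : Type v) [Group G]

instance (V : FDRep k G) : (tensorLeft V).PreservesProjectiveObjects :=
  have : RigidCategory (FDRep k G) := BraidedCategory.rigidCategoryOfRightRigidCategory
  tensorLeft_preservesProjective V

instance (V : FDRep k G) : (tensorRight V).PreservesProjectiveObjects :=
  have : RigidCategory (FDRep k G) := BraidedCategory.rigidCategoryOfRightRigidCategory
  tensorRight_preservesProjective V

/-- The stable category of finitely generated `kG`-modules, with its tensor product over `k`. -/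
abbrev StMod := Stab (FDRep k G)

/-- The group of endotrivial modules: the Picard group of isomorphism classes of tensor-invertible
objects of the stable category of finitely generated `kG`-modules. -/
abbrev EndotrivialGroup := (Skeleton (StMod k G))ˣ

theorem aux_associativity {A : Type*} [Category* A] [MonoidalCategory A] (X Y Z : A) :
    𝟙 (X ⊗ Y) ▷ Z ≫ 𝟙 _ ≫ (α_ X Y Z).hom = (α_ X Y Z).hom ≫ X ◁ 𝟙 (Y ⊗ Z) ≫ 𝟙 _ := by
  simp

variable {G} (H : Subgroup G)

/-- Restriction of finitely generated modules from `G` to `H`. -/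
abbrev resFD : FDRep k G ⥤ FDRep k H := Action.res (FGModuleCat k) H.subtype

instance : (resFD k H).Monoidal :=
  Functor.CoreMonoidal.toMonoidal
    { εIso := Iso.refl _
      μIso := fun X Y => Iso.refl _
      μIso_hom_natural_left := fun f X => by
        ext1
        change f.hom ▷ X.V ≫ 𝟙 _ = 𝟙 _ ≫ f.hom ▷ X.V
        simp
      μIso_hom_natural_right := fun X f => by
        ext1
        change X.V ◁ f.hom ≫ 𝟙 _ = 𝟙 _ ≫ X.V ◁ f.hom
        simp
      associativity := fun X Y Z => by
        ext1
        change 𝟙 (X.V ⊗ Y.V) ▷ Z.V ≫ 𝟙 _ ≫ (α_ X Y Z).hom.hom =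
          (α_ ((resFD k H).obj X) ((resFD k H).obj Y) ((resFD k H).obj Z)).hom.hom ≫
            X.V ◁ 𝟙 (Y.V ⊗ Z.V) ≫ 𝟙 _
        rw [Action.associator_hom_hom, Action.associator_hom_hom]
        exact aux_associativity X.V Y.V Z.V
      left_unitality := fun X => by
        ext1
        change (λ_ ((resFD k H).obj X)).hom.hom =
          𝟙 (𝟙_ (FGModuleCat k)) ▷ X.V ≫ 𝟙 _ ≫ (λ_ X).hom.hom
        rw [Action.leftUnitor_hom_hom, Action.leftUnitor_hom_hom, id_whiskerRight]
        rfl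
      right_unitality := fun X => by
        ext1
        change (ρ_ ((resFD k H).obj X)).hom.hom =
          X.V ◁ 𝟙 (𝟙_ (FGModuleCat k)) ≫ 𝟙 _ ≫ (ρ_ X).hom.hom
        rw [Action.rightUnitor_hom_hom, Action.rightUnitor_hom_hom, whiskerLeft_id]
        rfl }

variable [Finite G]

instance {M : Type*} [Group M] [Finite M] (x : SingleObj M) :
    Finite (Σ y : SingleObj M, y ⟶ x) :=
  Finite.of_surjective (fun g : M => (⟨SingleObj.star M, g⟩ : Σ y : SingleObj M, y ⟶ x))
    fun a => ⟨a.2, rfl⟩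

instance : (resFD k H).PreservesProjectiveObjects where
  projective_obj {P} hP := by
    have := HasFiniteBiproducts.of_hasFiniteProducts (C := FGModuleCat k)
    let F : SingleObj H ⥤ SingleObj G := SingleObj.mapHom _ _ H.subtype
    have hF : F.Faithful := ⟨fun {_ _ a b} h => Subtype.ext h⟩
    have h1 : Projective ((Action.functorCategoryEquivalence (FGModuleCat k) G).functor.obj P) :=
      ((Action.functorCategoryEquivalence (FGModuleCat k) G).map_projective_iff P).mpr hP
    have h2 := projective_comp_faithful (projective_fgModuleCat k) F
      ((Action.functorCategoryEquivalence (FGModuleCat k) G).functor.obj P)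
    exact ((Action.functorCategoryEquivalence (FGModuleCat k) H).map_projective_iff
      ((resFD k H).obj P)).mp h2

/-- The restriction homomorphism `T(G) → T(H)`. -/
noncomputable def resT : EndotrivialGroup k G →* EndotrivialGroup k H :=
  Units.map (Skeleton.monoidHom (stabMap (resFD k H)))

/-- The kernel `T(G, H)` of restriction. -/
noncomputable abbrev EndotrivialKer : Subgroup (EndotrivialGroup k G) := (resT k H).ker

end Endotrivial

section GSets

variable {G : Type v} [Group G]

variable (G) in
/-- The category of finite `G`-sets. -/
abbrev GSet := Action FintypeCat.{v} G

variable (G) in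
/-- A finite type with a `G`-action as an object of the category of finite `G`-sets. -/
abbrev gset (X : Type v) [MulAction G X] [Finite X] : GSet G :=
  @Action.FintypeCat.ofMulAction G (FintypeCat.of X) _ ‹MulAction G X›

/-- An equivariant map as a morphism of finite `G`-sets. -/
def gsetHom {X Y : GSet G} (f : X.V → Y.V) (hf : ∀ (g : G) (x : X.V), f (g • x) = g • f x) :
    X ⟶ Y where
  hom := FintypeCat.homMk f
  comm g := by
    ext x
    exact hf g x

theorem gset_hom_smul {X Y : GSet G} (φ : X ⟶ Y) (g : G) (x : X.V) :
    φ.hom (g • x) = g • φ.hom x :=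
  ConcreteCategory.congr_hom (φ.comm g) x

theorem gset_stabilizer_le {X Y : GSet G} (φ : X ⟶ Y) (x : X.V) :
    MulAction.stabilizer G x ≤ MulAction.stabilizer G (φ.hom x) := fun g hg => by
  rw [MulAction.mem_stabilizer_iff] at hg ⊢
  rw [← gset_hom_smul, hg]

/-- A map `α : U ⟶ X` of finite `G`-sets is a sipp-cover when every `x` in `X` has a preimage `u`
such that the index of the stabilizer of `u` in the stabilizer of `x` is prime to `p`. -/
def IsSippCover (p : ℕ) {U X : GSet G} (α : U ⟶ X) : Prop :=
  ∀ x : X.V, ∃ u : U.V, α.hom u = x ∧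
    ((MulAction.stabilizer G u).relIndex (MulAction.stabilizer G x)).Coprime p

/-- The projection `G/H ⟶ G/G`. -/
def orbitCover [Finite G] (H : Subgroup G) : gset G (G ⧸ H) ⟶ gset G (G ⧸ (⊤ : Subgroup G)) :=
  gsetHom (Subgroup.quotientMapOfLE le_top) fun g x => by
    induction x using QuotientGroup.induction_on
    rfl

/-- The `n`-fold fibre product `U ×_X ⋯ ×_X U`, for `n ≥ 1`. -/
abbrev FibPow {U X : GSet G} (α : U ⟶ X) (n : ℕ) : Type v :=
  {u : Fin n → U.V // ∀ i j, α.hom (u i) = α.hom (u j)}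

instance {U X : GSet G} (α : U ⟶ X) (n : ℕ) : MulAction G (FibPow α n) where
  smul g u := ⟨fun i => g • u.1 i, fun i j => by
    rw [gset_hom_smul, gset_hom_smul, u.2 i j]⟩
  one_smul u := Subtype.ext (funext fun i => one_smul G (u.1 i))
  mul_smul g h u := Subtype.ext (funext fun i => mul_smul g h (u.1 i))

/-- The `n`-fold fibre product as a finite `G`-set. -/
abbrev fibPow {U X : GSet G} (α : U ⟶ X) (n : ℕ) : GSet G := gset G (FibPow α n)

/-- The `i`-th projection of the fibre product. -/
def fibProj {U X : GSet G} (α : U ⟶ X) {n : ℕ} (i : Fin n) : fibPow α n ⟶ U :=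
  gsetHom (fun u : FibPow α n => u.1 i) fun _ _ => rfl

/-- The projection of the fibre product that omits the `i`-th factor. -/
def fibFace {U X : GSet G} (α : U ⟶ X) {n : ℕ} (i : Fin (n + 1)) :
    fibPow α (n + 1) ⟶ fibPow α n :=
  gsetHom (fun u : FibPow α (n + 1) =>
    (⟨fun j => u.1 (i.succAbove j), fun _ _ => u.2 _ _⟩ : FibPow α n)) fun _ _ => rfl

end GSets

section Cech

variable {G : Type v} [Group G] (P : (GSet G)ᵒᵖ ⥤ AddCommGrpCat.{w}) {U X : GSet G} (α : U ⟶ X)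

/-- The differential of the Čech complex, from degree `n`, where the group is the value of `P` at
the `(n + 1)`-fold fibre product, to degree `n + 1`. -/
noncomputable def cechD (n : ℕ) :
    P.obj (op (fibPow α (n + 1))) →+ P.obj (op (fibPow α (n + 2))) :=
  ∑ i : Fin (n + 2), ((-1 : ℤ) ^ (i : ℕ)) • (P.map (fibFace α i).op).hom

/-- The coboundaries of the Čech complex. -/
noncomputable def cechB : ∀ n : ℕ, AddSubgroup (P.obj (op (fibPow α (n + 1))))
  | 0 => ⊥
  | n + 1 => (cechD P α n).range

/-- Čech cohomology: cocycles modulo coboundaries. -/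
abbrev CechH (n : ℕ) : Type w :=
  (cechD P α n).ker ⧸ (cechB P α n).addSubgroupOf (cechD P α n).ker

/-- The cohomology class of a cocycle. -/
noncomputable def CechH.mk {P : (GSet G)ᵒᵖ ⥤ AddCommGrpCat.{w}} {U X : GSet G} {α : U ⟶ X}
    {n : ℕ} (z : P.obj (op (fibPow α (n + 1)))) (hz : cechD P α n z = 0) :
    CechH P α n :=
  QuotientAddGroup.mk (⟨z, hz⟩ : (cechD P α n).ker)

end Cech

section Sheaves

variable {G : Type v} [Group G]

/-- The set of orbits of points whose stabilizer has order divisible by `p`. -/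
def POrbits (p : ℕ) (X : GSet G) : Type v :=
  {o : MulAction.orbitRel.Quotient G X.V //
    ∃ x : X.V, Quotient.mk _ x = o ∧ p ∣ Nat.card (MulAction.stabilizer G x)}

/-- The orbit of a point whose stabilizer has order divisible by `p`. -/
def pOrbit {p : ℕ} {X : GSet G} (x : X.V) (hx : p ∣ Nat.card (MulAction.stabilizer G x)) :
    POrbits p X :=
  ⟨Quotient.mk _ x, x, rfl, hx⟩

/-- Functoriality of the set of orbits with stabilizer of order divisible by `p`. -/
def POrbits.map {p : ℕ} {X Y : GSet G} (φ : X ⟶ Y) (o : POrbits p X) : POrbits p Y :=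
  ⟨Quotient.map φ.hom (fun a b h => by
      obtain ⟨g, rfl⟩ := h
      exact ⟨g, (gset_hom_smul φ g b).symm⟩) o.1, by
    obtain ⟨x, hx, hp⟩ := o.2
    refine ⟨φ.hom x, by rw [← hx]; rfl, hp.trans ?_⟩
    exact Subgroup.card_dvd_of_le (gset_stabilizer_le φ x)⟩

variable (G) in
/-- The constant sipp sheaf associated to an abelian group `A`: its value at `X` is the group of
functions from the set of orbits of `X` with stabilizer of order divisible by `p` to `A`. -/
def constSheaf (p : ℕ) (A : Type u) [AddCommGroup A] : (GSet G)ᵒᵖ ⥤ AddCommGrpCat.{max u v} where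
  obj X := AddCommGrpCat.of (POrbits p X.unop → A)
  map φ := AddCommGrpCat.ofHom
    { toFun := fun c o => c (POrbits.map φ.unop o)
      map_zero' := rfl
      map_add' := fun _ _ => rfl }
  map_id X := by
    ext c o
    obtain ⟨o, ho⟩ := o
    induction o using Quotient.inductionOn
    rfl
  map_comp φ ψ := by
    ext c o
    obtain ⟨o, ho⟩ := o
    induction o using Quotient.inductionOn
    rfl

variable (k : Type u) [Field k]

/-- Representations of the `G`-set `X`: functors from the action groupoid of `X` to vector
spaces. -/
abbrev GRep (X : GSet G) := ActionCategory G X.V ⥤ ModuleCat.{u} k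

/-- The stable category of representations of `X`. -/
abbrev StRep (X : GSet G) := Stab (GRep k X)

/-- The functor of action groupoids induced by a map of `G`-sets. -/
def actionMap {X Y : GSet G} (φ : Y ⟶ X) : ActionCategory G Y.V ⥤ ActionCategory G X.V where
  obj y := ⟨(), φ.hom y.back⟩
  map {y z} g := ⟨g.1, by
    have h : g.1 • y.back = z.back := g.2
    change g.1 • φ.hom y.back = φ.hom z.back
    rw [← gset_hom_smul, h]⟩
  map_id _ := rfl
  map_comp _ _ := rfl

instance {X Y : GSet G} (φ : Y ⟶ X) : (actionMap φ).Faithful where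
  map_injective h := Subtype.ext (congrArg (fun t => (t.1 : G)) h)

/-- The pull-back of representations along a map of `G`-sets. -/
abbrev pull {X Y : GSet G} (φ : Y ⟶ X) : GRep k X ⥤ GRep k Y :=
  (Functor.whiskeringLeft _ _ _).obj (actionMap φ)

/-- The unit representation, with value `k` at every point and identity maps. -/
abbrev unitRep (X : GSet G) : GRep k X := (Functor.const _).obj (ModuleCat.of k k)

/-- The unit representation as an object of the stable category. -/
abbrev stUnit (X : GSet G) : StRep k X := (toStab _).obj (unitRep k X)

instance (X : GSet G) : CommGroup (Aut (stUnit k X)) where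
  mul_comm a b := by
    apply Iso.ext
    obtain ⟨f, hf⟩ := (toStab (GRep k X)).map_surjective a.hom
    obtain ⟨g, hg⟩ := (toStab (GRep k X)).map_surjective b.hom
    change b.hom ≫ a.hom = a.hom ≫ b.hom
    rw [← hf, ← hg, ← Functor.map_comp, ← Functor.map_comp]
    congr 1
    ext x : 2
    change g.app x ≫ f.app x = f.app x ≫ g.app x
    refine ModuleCat.hom_ext (LinearMap.ext_ring ?_)
    change (f.app x).hom ((g.app x).hom (1 : k)) = (g.app x).hom ((f.app x).hom (1 : k))
    have hf' := (f.app x).hom.map_smul ((g.app x).hom (1 : k) : k) (1 : k)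
    have hg' := (g.app x).hom.map_smul ((f.app x).hom (1 : k) : k) (1 : k)
    simp only [smul_eq_mul, mul_one] at hf' hg'
    rw [hf', hg']
    exact mul_comm (G := k) _ _

/-- The representation of `X` defined by a `kG`-module `V`: its value at every point is `V`, and
the arrow given by `g` acts as `g` on `V`. It is the pull-back of `V`, seen as a representation of
the one-point `G`-set. -/
abbrev constRep (V : FDRep k G) (X : GSet G) : GRep k X :=
  ActionCategory.π G X.V ⋙ (Action.functorCategoryEquivalence (FGModuleCat k) G).functor.obj V ⋙
    forget₂ (FGModuleCat k) (ModuleCat k)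

variable [Finite G]

instance (X : GSet G) (x : ActionCategory G X.V) : Finite (Σ y : ActionCategory G X.V, y ⟶ x) := by
  have h1 : Finite (ActionCategory G X.V) := Finite.of_equiv _ (ActionCategory.objEquiv G X.V)
  have h2 : ∀ y : ActionCategory G X.V, Finite (y ⟶ x) := fun y =>
    Finite.of_injective (fun g : (y ⟶ x) => (g.1 : G)) fun _ _ h => Subtype.ext h
  infer_instance

instance (X : GSet G) : IsGroupoid (ActionCategory G X.V) where
  all_isIso {x y} g := by
    let g' : G := g.1
    have h : g' • x.back = y.back := g.2
    let i : y ⟶ x := ⟨g'⁻¹, by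
      change g'⁻¹ • y.back = x.back
      rw [← h, inv_smul_smul]⟩
    exact ⟨i, Subtype.ext (inv_mul_cancel g'), Subtype.ext (mul_inv_cancel g')⟩

instance {X Y : GSet G} (φ : Y ⟶ X) : (pull k φ).PreservesProjectiveObjects where
  projective_obj {P} _ := projective_comp_faithful (fun _ => inferInstance) (actionMap φ) P

/-- The pull-back of stable representations along a map of `G`-sets. -/
abbrev stPull {X Y : GSet G} (φ : Y ⟶ X) : StRep k X ⥤ StRep k Y := stabMap (pull k φ)

variable (G) in
/-- The presheaf of stable automorphisms of the unit representation, written additively. -/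
def Gm : (GSet G)ᵒᵖ ⥤ AddCommGrpCat.{max u v} where
  obj X := AddCommGrpCat.of (Additive (Aut (stUnit k X.unop)))
  map {X Y} φ := AddCommGrpCat.ofHom
    (MonoidHom.toAdditive ((stPull k φ.unop).mapAut (stUnit k X.unop)))
  map_id X := by
    ext a
    refine congrArg Additive.ofMul (Iso.ext ?_)
    obtain ⟨f, hf⟩ := (toStab (GRep k X.unop)).map_surjective (Additive.toMul a).hom
    change (stPull k (𝟙 X.unop)).map (Additive.toMul a).hom = (Additive.toMul a).hom
    rw [← hf]
    rfl
  map_comp {X Y Z} φ ψ := by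
    ext a
    refine congrArg Additive.ofMul (Iso.ext ?_)
    obtain ⟨f, hf⟩ := (toStab (GRep k X.unop)).map_surjective (Additive.toMul a).hom
    change (stPull k (ψ.unop ≫ φ.unop)).map (Additive.toMul a).hom =
      (stPull k ψ.unop).map ((stPull k φ.unop).map (Additive.toMul a).hom)
    rw [← hf]
    rfl

/-- The class of the representation defined by `V` in the stable category. -/
abbrev stConst (V : FDRep k G) (X : GSet G) : StRep k X := (toStab _).obj (constRep k V X)

/-- The pull-back of an isomorphism between `V` and the unit. -/
def pullTriv {k : Type u} [Field k] {X Y : GSet G} (φ : Y ⟶ X) {V : FDRep k G}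
    (f : stConst k V X ≅ stUnit k X) : stConst k V Y ≅ stUnit k Y :=
  (stPull k φ).mapIso f

/-- For an isomorphism `f` between the pull-back of `V` to `U` and the unit in the stable category
of representations of `U`, the automorphism `pr₁^*(f) ∘ pr₂^*(f)⁻¹` of the unit over the two-fold
fibre product of `U`. -/
def gluing {k : Type u} [Field k] {U X : GSet G} (α : U ⟶ X) {V : FDRep k G}
    (f : stConst k V U ≅ stUnit k U) : (Gm G k).obj (op (fibPow α 2)) :=
  Additive.ofMul (α := Aut (stUnit k (fibPow α 2)))
    ((pullTriv (fibProj α 1) f).symm ≪≫ pullTriv (fibProj α 0) f)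

end Sheaves

end SippCech

open SippCech

/-!
Morphisms between constant representations of a `G`-set `X` are equivariant families of linear maps
indexed by `X`, and such a family factors through a projective object if and only if it is a trace
`x ↦ ∑ g, g ∘ θ (g⁻¹ x) ∘ g⁻¹` of some family `θ`. Stable isomorphisms are thus families that are
invertible up to traces. The traces among the equivariant families of scalars are the invariant
functions that vanish wherever the order of the stabilizer is zero in `k`, and this is (i).

For (ii), suppose that the two pullbacks of a stable trivialization of `V` over `G ⧸ H` to
`(G ⧸ H)²` agree stably. Then its average over `G ⧸ H`, which exists because the index is invertible
in `k`, is a stable isomorphism from `V` to the trivial module, so that `Φ` is injective. For the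
surjectivity, the matrix `c x y / |G ⧸ H|` of a cocycle `c` is an endomorphism of `k ^ (G ⧸ H)` that
is idempotent up to traces. The finite-dimensional commutative algebra which it generates contains
an honest idempotent stably equal to it, and the image of that idempotent is a module with gluing
cocycle `c`. The module of the inverse cocycle is its tensor inverse.
-/

namespace SippCech

section StableRel

variable {C D : Type*} [Category* C] [Category* D] [Preadditive C] [Preadditive D]

instance [HasBinaryBiproducts C] [HasZeroObject C] : Congruence (stableRel C) where
  comp_left f _ _ := by
    rintro ⟨P, hP, a, b, hab⟩
    exact ⟨P, hP, f ≫ a, b, by rw [← Preadditive.comp_sub, hab, Category.assoc]⟩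
  comp_right g := by
    rintro ⟨P, hP, a, b, hab⟩
    exact ⟨P, hP, a, b ≫ g, by rw [← Preadditive.sub_comp, hab, Category.assoc]⟩
  equivalence :=
    { refl f := ⟨_, Projective.zero_projective, 0, 0, by simp⟩
      symm := by
        rintro _ _ ⟨P, hP, a, b, hab⟩
        exact ⟨P, hP, -a, b, by rw [← neg_sub, hab, Preadditive.neg_comp]⟩
      trans := by
        rintro _ _ _ ⟨P, hP, a, b, hab⟩ ⟨P', hP', a', b', hab'⟩
        exact ⟨P ⊞ P', inferInstance, biprod.lift a a', biprod.desc b b', by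
          rw [biprod.lift_desc, ← hab, ← hab', sub_add_sub_cancel]⟩ }

theorem toStab_map_eq_iff [HasBinaryBiproducts C] [HasZeroObject C] {X Y : C} (f g : X ⟶ Y) :
    (toStab C).map f = (toStab C).map g ↔ stableRel C f g :=
  CategoryTheory.Quotient.functor_map_eq_iff _ _ _

theorem stableRel_equivalence_iff (E : C ≌ D) [E.functor.Additive] {X Y : C} (f g : X ⟶ Y) :
    stableRel D (E.functor.map f) (E.functor.map g) ↔ stableRel C f g := by
  constructor
  · rintro ⟨P, hP, a, b, hab⟩
    refine ⟨E.inverse.obj P, (E.symm.map_projective_iff P).mpr hP,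
      E.unit.app X ≫ E.inverse.map a, E.inverse.map b ≫ E.unitInv.app Y, ?_⟩
    rw [Category.assoc, ← E.inverse.map_comp_assoc, ← hab, ← E.functor.map_sub]
    simp
  · rintro ⟨P, hP, a, b, hab⟩
    exact ⟨E.functor.obj P, (E.map_projective_iff P).mpr hP, E.functor.map a, E.functor.map b, by
      rw [← E.functor.map_sub, hab, E.functor.map_comp]⟩

end StableRel

section TraceHom

variable {J A : Type*} [Category* J] [IsGroupoid J] [Category* A] [Preadditive A]
  [∀ x : J, Finite (Σ y : J, y ⟶ x)] {P Q R : J ⥤ A}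

/-- The trace of a family of maps: the natural transformation obtained by summing the conjugates
of the family over all arrows with a given target. -/
noncomputable def traceHom (θ : ∀ x, P.obj x ⟶ Q.obj x) : P ⟶ Q where
  app x :=
    letI := Fintype.ofFinite (Σ y : J, y ⟶ x)
    ∑ a : (Σ y : J, y ⟶ x), P.map (inv a.2) ≫ θ a.1 ≫ Q.map a.2
  naturality x x' h := by
    let _ := fun x : J => Fintype.ofFinite (Σ y : J, y ⟶ x)
    let postcomp : (Σ y : J, y ⟶ x) ≃ (Σ y : J, y ⟶ x') :=
      { toFun a := ⟨a.1, a.2 ≫ h⟩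
        invFun a := ⟨a.1, a.2 ≫ inv h⟩
        left_inv a := by simp
        right_inv a := by simp }
    rw [← postcomp.sum_comp, Preadditive.comp_sum, Preadditive.sum_comp]
    exact Finset.sum_congr rfl fun a _ => by simp [postcomp]

theorem traceHom_app_eq_sum (θ : ∀ x, P.obj x ⟶ Q.obj x) {x : J} {ι : Type*} [Fintype ι]
    (e : ι ≃ Σ y : J, y ⟶ x) :
    (traceHom θ).app x = ∑ i, P.map (inv (e i).2) ≫ θ (e i).1 ≫ Q.map (e i).2 :=
  letI := Fintype.ofFinite (Σ y : J, y ⟶ x)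
  (e.sum_comp fun a => P.map (inv a.2) ≫ θ a.1 ≫ Q.map a.2).symm

theorem comp_traceHom (f : P ⟶ Q) (θ : ∀ x, Q.obj x ⟶ R.obj x) :
    f ≫ traceHom θ = traceHom fun x => f.app x ≫ θ x := by
  ext x
  simp only [traceHom, NatTrans.comp_app, Preadditive.comp_sum, Category.assoc,
    f.naturality_assoc]

theorem traceHom_comp (θ : ∀ x, P.obj x ⟶ Q.obj x) (f : Q ⟶ R) :
    traceHom θ ≫ f = traceHom fun x => θ x ≫ f.app x := by
  ext x
  simp [traceHom, Preadditive.sum_comp]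

theorem isTraceSplit_iff_exists_traceHom_eq_id :
    IsTraceSplit P ↔ ∃ θ : ∀ x, P.obj x ⟶ P.obj x, traceHom θ = 𝟙 P :=
  exists_congr fun _ => ⟨fun h => NatTrans.ext (funext h), fun h x => congrArg (fun f => f.app x) h⟩

theorem IsTraceSplit.comp_additive {B : Type*} [Category* B] [Preadditive B] (hP : IsTraceSplit P)
    (F : A ⥤ B) [F.Additive] : IsTraceSplit (P ⋙ F) := by
  obtain ⟨θ, hθ⟩ := hP
  refine ⟨fun x => F.map (θ x), fun x => ?_⟩
  simpa using congrArg F.map (hθ x)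

variable [HasFiniteBiproducts A]

/-- The inclusion `freeι` of a summand, as a map to a value of the functor `freeCover P`. -/
noncomputable def freeCoverι (P : J ⥤ A) {y x : J} (f : y ⟶ x) : P.obj y ⟶ (freeCover P).obj x :=
  freeι P f

theorem freeCoverι_map {y x x' : J} (f : y ⟶ x) (h : x ⟶ x') :
    freeCoverι P f ≫ (freeCover P).map h = freeCoverι P (f ≫ h) :=
  freeι_map P f h

theorem freeCover_hom_ext {x : J} {B : A} {u v : (freeCover P).obj x ⟶ B}
    (h : ∀ (y : J) (f : y ⟶ x), freeCoverι P f ≫ u = freeCoverι P f ≫ v) : u = v :=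
  freeObj_hom_ext P h

/-- The map out of a value of `freeCover P` with given components on the summands. -/
noncomputable def freeCoverDesc {B : A} {x : J} (d : ∀ a : (Σ y : J, y ⟶ x), P.obj a.1 ⟶ B) :
    (freeCover P).obj x ⟶ B :=
  biproduct.desc d

theorem freeCoverι_desc {B : A} {x : J} (d : ∀ a : (Σ y : J, y ⟶ x), P.obj a.1 ⟶ B) {y : J}
    (f : y ⟶ x) : freeCoverι P f ≫ freeCoverDesc d = d ⟨y, f⟩ :=
  biproduct.ι_desc _ _

/-- The morphism from the free representation on the objects of `P` that a family of maps
defines. -/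
noncomputable def freeLift (θ : ∀ x, P.obj x ⟶ Q.obj x) : freeCover P ⟶ Q where
  app x := freeCoverDesc fun a => θ a.1 ≫ Q.map a.2
  naturality x x' h := freeCover_hom_ext fun y f => by
    rw [← Category.assoc, freeCoverι_map, freeCoverι_desc, ← Category.assoc, freeCoverι_desc,
      Q.map_comp, Category.assoc]

theorem freeCoverι_freeLift (θ : ∀ x, P.obj x ⟶ Q.obj x) {y x : J} (f : y ⟶ x) :
    freeCoverι P f ≫ (freeLift θ).app x = θ y ≫ Q.map f :=
  freeCoverι_desc _ f

theorem projective_freeCover [HasPushouts A] (hA : ∀ V : A, Projective V) (P : J ⥤ A) :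
    Projective (freeCover P) := by
  refine ⟨fun {E X} f e he => ?_⟩
  have (x : J) : Epi (e.app x) := (NatTrans.epi_iff_epi_app e).mp he x
  have (x : J) : Projective (P.obj x) := hA _
  let θ (x : J) : P.obj x ⟶ E.obj x :=
    Projective.factorThru (freeCoverι P (𝟙 x) ≫ f.app x) (e.app x)
  have hθ (x : J) : θ x ≫ e.app x = freeCoverι P (𝟙 x) ≫ f.app x := Projective.factorThru_comp _ _
  refine ⟨freeLift θ, NatTrans.ext (funext fun x => freeCover_hom_ext fun y g => ?_)⟩
  calc freeCoverι P g ≫ (freeLift θ).app x ≫ e.app x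
      = (θ y ≫ e.app y) ≫ X.map g := by
        rw [← Category.assoc, freeCoverι_freeLift, Category.assoc, e.naturality, Category.assoc]
    _ = freeCoverι P (𝟙 y) ≫ (freeCover P).map g ≫ f.app x := by
        rw [hθ, Category.assoc, f.naturality]
    _ = freeCoverι P g ≫ f.app x := by rw [← Category.assoc, freeCoverι_map, Category.id_comp]

theorem traceHom_eq_comp_freeLift (θ : ∀ x, P.obj x ⟶ Q.obj x) :
    traceHom θ = traceHom (fun x => freeCoverι P (𝟙 x)) ≫ freeLift θ := by
  rw [traceHom_comp]
  congr with x
  rw [freeCoverι_freeLift, Q.map_id, Category.comp_id]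

theorem stableRel_iff_exists_traceHom_eq [HasPushouts A] (hA : ∀ V : A, Projective V)
    (f g : P ⟶ Q) : stableRel (J ⥤ A) f g ↔ ∃ θ, traceHom θ = f - g := by
  constructor
  · rintro ⟨R, hR, a, b, hab⟩
    obtain ⟨θ, hθ⟩ := isTraceSplit_iff_exists_traceHom_eq_id.mp (isTraceSplit_of_projective R)
    refine ⟨fun x => a.app x ≫ θ x ≫ b.app x, ?_⟩
    rw [← comp_traceHom, ← traceHom_comp, hθ, Category.id_comp, hab]
  · rintro ⟨θ, hθ⟩
    exact ⟨_, projective_freeCover hA P, _, _, hθ.symm.trans (traceHom_eq_comp_freeLift θ)⟩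

end TraceHom

section ConstRep

variable (k : Type u) [Field k] {G : Type v} [Group G]

/-- The construction `constRep` of a representation of the `G`-set `X` from a `kG`-module, as a
functor. -/
noncomputable def constRepFunctor (X : GSet G) : FDRep k G ⥤ GRep k X :=
  (Action.functorCategoryEquivalence (FGModuleCat k) G).functor ⋙
    (Functor.whiskeringRight _ _ _).obj (forget₂ (FGModuleCat k) (ModuleCat k)) ⋙
      (Functor.whiskeringLeft _ _ _).obj (ActionCategory.π G X.V)

instance (X : GSet G) : (constRepFunctor k X).Additive where

variable [Finite G]

instance (X : GSet G) : (constRepFunctor k X).PreservesProjectiveObjects where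
  projective_obj {P} hP := by
    have := HasFiniteBiproducts.of_hasFiniteProducts (C := FGModuleCat k)
    have hfaithful : (ActionCategory.π G X.V).Faithful := ⟨fun h => Subtype.ext h⟩
    let E := Action.functorCategoryEquivalence (FGModuleCat k) G
    have hEP : Projective (E.functor.obj P) := (E.map_projective_iff P).mpr hP
    exact projective_of_isTraceSplit (fun _ => inferInstance) _
      (((isTraceSplit_of_projective _).comp_additive _).comp_faithful _)

variable {k}

/-- The isomorphism of stable representations of `X` induced by a stable isomorphism of
`kG`-modules. -/
noncomputable def stConstMapIso {V V' : FDRep k G} (e : (toStab _).obj V ≅ (toStab _).obj V')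
    (X : GSet G) : stConst k V X ≅ stConst k V' X :=
  (stabMap (constRepFunctor k X)).mapIso e

theorem stPull_mapIso_stConstMapIso {V V' : FDRep k G}
    (e : (toStab _).obj V ≅ (toStab _).obj V') {X Y : GSet G} (φ : Y ⟶ X) :
    (stPull k φ).mapIso (stConstMapIso e X) = stConstMapIso e Y := by
  obtain ⟨f, hf⟩ := (toStab (FDRep k G)).map_surjective e.hom
  ext
  change (stPull k φ).map ((stabMap (constRepFunctor k X)).map e.hom) =
    (stabMap (constRepFunctor k Y)).map e.hom
  rw [← hf]
  rfl

end ConstRep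

section Transition

variable {k : Type u} [Field k] {G : Type v} [Group G] [Finite G] {V V' : FDRep k G}
  {W X Y : GSet G}

/-- An automorphism of the stable unit as a section of `Gm`, which is written additively. -/
def gmOfIso (a : stUnit k X ≅ stUnit k X) : (Gm G k).obj (op X) :=
  Additive.ofMul (α := Aut (stUnit k X)) a

theorem gmOfIso_trans (a b : stUnit k X ≅ stUnit k X) :
    gmOfIso (a ≪≫ b) = gmOfIso b + gmOfIso a := rfl

theorem gmOfIso_symm (a : stUnit k X ≅ stUnit k X) : gmOfIso a.symm = -gmOfIso a := rfl

/-- The transition automorphism `φ^*(f) ∘ ψ^*(f)⁻¹` of the unit, for a trivialization `f` over `X`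
and two maps `φ` and `ψ` to `X`. -/
def transition (φ ψ : Y ⟶ X) (f : stConst k V X ≅ stUnit k X) : (Gm G k).obj (op Y) :=
  gmOfIso ((pullTriv ψ f).symm ≪≫ pullTriv φ f)

theorem transition_add_transition (φ ψ χ : Y ⟶ X) (f : stConst k V X ≅ stUnit k X) :
    transition φ ψ f + transition ψ χ f = transition φ χ f := by
  rw [transition, transition, ← gmOfIso_trans, Iso.trans_assoc, Iso.self_symm_id_assoc]
  rfl

theorem pullTriv_comp (χ : W ⟶ Y) (φ : Y ⟶ X) (f : stConst k V X ≅ stUnit k X) :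
    pullTriv χ (pullTriv φ f) = pullTriv (χ ≫ φ) f := by
  obtain ⟨g, hg⟩ := (toStab (GRep k X)).map_surjective f.hom
  ext
  change (stPull k χ).map ((stPull k φ).map f.hom) = (stPull k (χ ≫ φ)).map f.hom
  rw [← hg]
  rfl

theorem Gm_map_transition (χ : W ⟶ Y) (φ ψ : Y ⟶ X) (f : stConst k V X ≅ stUnit k X) :
    (Gm G k).map χ.op (transition φ ψ f) = transition (χ ≫ φ) (χ ≫ ψ) f := by
  rw [transition, transition, ← pullTriv_comp, ← pullTriv_comp]
  exact congrArg gmOfIso ((stPull k χ).mapIso_trans _ _)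

theorem transition_trans (φ ψ : Y ⟶ X) (f : stConst k V X ≅ stUnit k X)
    (a : stUnit k X ≅ stUnit k X) :
    transition φ ψ (f ≪≫ a) =
      (Gm G k).map φ.op (gmOfIso a) + transition φ ψ f -
        (Gm G k).map ψ.op (gmOfIso a) := by
  let aY (χ : Y ⟶ X) : stUnit k Y ≅ stUnit k Y := (stPull k χ).mapIso a
  have h (χ : Y ⟶ X) : pullTriv χ (f ≪≫ a) = pullTriv χ f ≪≫ aY χ := Functor.mapIso_trans _ _ _
  rw [transition, h, h, Iso.trans_symm, Iso.trans_assoc, gmOfIso_trans, gmOfIso_symm,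
    ← Iso.trans_assoc, gmOfIso_trans, sub_eq_add_neg]
  rfl

theorem transition_stConstMapIso_trans (e : (toStab _).obj V ≅ (toStab _).obj V')
    (φ ψ : Y ⟶ X) (f : stConst k V' X ≅ stUnit k X) :
    transition φ ψ (stConstMapIso e X ≪≫ f) = transition φ ψ f := by
  have h (φ : Y ⟶ X) : pullTriv φ (stConstMapIso e X ≪≫ f) = stConstMapIso e Y ≪≫ pullTriv φ f := by
    rw [pullTriv, Functor.mapIso_trans, stPull_mapIso_stConstMapIso]
    rfl
  rw [transition, transition, h, h, Iso.trans_symm, Iso.trans_assoc, Iso.symm_self_id_assoc]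

end Transition

section CechLowDegree

variable {G : Type v} [Group G] (P : (GSet G)ᵒᵖ ⥤ AddCommGrpCat.{w}) {U X : GSet G} (α : U ⟶ X)

theorem cechD_zero_apply (z : P.obj (op (fibPow α 1))) :
    cechD P α 0 z = P.map (fibFace α 0).op z - P.map (fibFace α 1).op z := by
  rw [cechD, Fin.sum_univ_two]
  simp [sub_eq_add_neg]

theorem cechD_one_apply (z : P.obj (op (fibPow α 2))) :
    cechD P α 1 z =
      P.map (fibFace α 0).op z - P.map (fibFace α 1).op z + P.map (fibFace α 2).op z := by
  rw [cechD, Fin.sum_univ_three]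
  simp [sub_eq_add_neg]

/-- The diagonal map from `U` to its one-fold fibre power. -/
def fibDiag : U ⟶ fibPow α 1 :=
  gsetHom (fun u => (⟨fun _ => u, fun _ _ => rfl⟩ : FibPow α 1)) fun _ _ => rfl

theorem fibProj_comp_fibDiag (i : Fin 2) :
    fibProj α (i.succAbove 0) ≫ fibDiag α = fibFace α i := by
  ext w
  exact Subtype.ext (funext fun j => by rw [Subsingleton.elim j 0]; rfl)

theorem mem_range_cechD_zero_iff {z : P.obj (op (fibPow α 2))} :
    z ∈ (cechD P α 0).range ↔
      ∃ a : P.obj (op U), P.map (fibProj α 1).op a - P.map (fibProj α 0).op a = z := by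
  constructor
  · rintro ⟨b, rfl⟩
    refine ⟨P.map (fibDiag α).op b, ?_⟩
    rw [cechD_zero_apply, ← fibProj_comp_fibDiag, ← fibProj_comp_fibDiag]
    simp
  · rintro ⟨a, rfl⟩
    refine ⟨P.map (fibProj α 0).op a, ?_⟩
    rw [cechD_zero_apply, ← ConcreteCategory.comp_apply, ← ConcreteCategory.comp_apply,
      ← P.map_comp, ← P.map_comp]
    rfl

end CechLowDegree

section Gluing

variable {k : Type u} [Field k] {G : Type v} [Group G] [Finite G] {V V' : FDRep k G}
  {U X : GSet G} (α : U ⟶ X)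

theorem cechD_gluing (f : stConst k V U ≅ stUnit k U) :
    cechD (Gm G k) α 1 (gluing α f) = 0 := by
  have hface (i : Fin 3) : (Gm G k).map (fibFace α i).op (gluing α f) =
      transition (fibProj α (i.succAbove 0)) (fibProj α (i.succAbove 1)) f :=
    Gm_map_transition (fibFace α i) (fibProj α 0) (fibProj α 1) f
  rw [cechD_one_apply, hface, hface, hface]
  rw [sub_add_eq_add_sub, sub_eq_zero]
  exact (add_comm _ _).trans (transition_add_transition _ _ _ f)

theorem gluing_sub_gluing_mem (e : (toStab _).obj V ≅ (toStab _).obj V')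
    (f : stConst k V U ≅ stUnit k U) (f' : stConst k V' U ≅ stUnit k U) :
    gluing α f - gluing α f' ∈ (cechD (Gm G k) α 0).range := by
  let a : stUnit k U ≅ stUnit k U := (stConstMapIso e U ≪≫ f').symm ≪≫ f
  have hf : f = (stConstMapIso e U ≪≫ f') ≪≫ a := (Iso.self_symm_id_assoc _ f).symm
  let δ (i : Fin 2) : (Gm G k).obj (op (fibPow α 2)) :=
    (Gm G k).map (fibProj α i).op (gmOfIso a)
  have hgluing : gluing α f = δ 0 + gluing α f' - δ 1 := by
    rw [hf]
    refine (transition_trans (fibProj α 0) (fibProj α 1) _ a).trans ?_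
    rw [transition_stConstMapIso_trans]
    rfl
  refine (mem_range_cechD_zero_iff _ α).mpr ⟨-gmOfIso a, ?_⟩
  rw [hgluing, map_neg, map_neg]
  change -δ 1 - -δ 0 = δ 0 + gluing α f' - δ 1 - gluing α f'
  abel

end Gluing

section Families

variable {k G X Y V W Z V' W' : Type*} [CommRing k] [Group G] [MulAction G X] [MulAction G Y]
  [AddCommGroup V] [Module k V] [AddCommGroup W] [Module k W] [AddCommGroup Z] [Module k Z]
  [AddCommGroup V'] [Module k V'] [AddCommGroup W'] [Module k W']
  {ρ : Representation k G V} {σ : Representation k G W} {τ : Representation k G Z}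
  {ρ' : Representation k G V'} {σ' : Representation k G W'}

theorem linearMap_comp_sum {ι : Type*} [Fintype ι] (f : W →ₗ[k] Z) (g : ι → V →ₗ[k] W) :
    f ∘ₗ (∑ i, g i) = ∑ i, f ∘ₗ g i :=
  map_sum (LinearMap.compRight k f) _ _

theorem sum_linearMap_comp {ι : Type*} [Fintype ι] (f : ι → W →ₗ[k] Z) (g : V →ₗ[k] W) :
    (∑ i, f i) ∘ₗ g = ∑ i, f i ∘ₗ g :=
  map_sum (LinearMap.lcomp k Z g) _ _

/-- A family of linear maps indexed by a `G`-set that commutes with the action of `G`. For fixed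
representations these are the maps between the corresponding constant representations of the
action groupoid. -/
def IsEquivariant (ρ : Representation k G V) (σ : Representation k G W)
    (F : X → V →ₗ[k] W) : Prop :=
  ∀ (g : G) (x : X), F (g • x) ∘ₗ ρ g = σ g ∘ₗ F x

namespace IsEquivariant

theorem id : IsEquivariant ρ ρ (fun _ : X => LinearMap.id) := fun _ _ => rfl

theorem comp {E : X → W →ₗ[k] Z} {F : X → V →ₗ[k] W} (hE : IsEquivariant σ τ E)
    (hF : IsEquivariant ρ σ F) : IsEquivariant ρ τ (fun x => E x ∘ₗ F x) := fun g x => by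
  rw [LinearMap.comp_assoc, hF, ← LinearMap.comp_assoc, hE, LinearMap.comp_assoc]

theorem pull {F : X → V →ₗ[k] W} (hF : IsEquivariant ρ σ F) {φ : Y → X}
    (hφ : ∀ (g : G) y, φ (g • y) = g • φ y) : IsEquivariant ρ σ (fun y => F (φ y)) := fun g y => by
  beta_reduce
  rw [hφ, hF]

theorem smul {F : X → V →ₗ[k] W} (hF : IsEquivariant ρ σ F) {a : X → k}
    (ha : ∀ (g : G) x, a (g • x) = a x) : IsEquivariant ρ σ (fun x => a x • F x) := fun g x => by
  beta_reduce
  rw [ha, LinearMap.smul_comp, hF, LinearMap.comp_smul]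

theorem sum_fiber [Fintype Y] {F : X × Y → V →ₗ[k] W} (hF : IsEquivariant ρ σ F) :
    IsEquivariant ρ σ (fun x => ∑ y, F (x, y)) := fun g x => by
  beta_reduce
  rw [sum_linearMap_comp, linearMap_comp_sum, ← Equiv.sum_comp (MulAction.toPerm g)]
  exact Finset.sum_congr rfl fun y _ => hF g (x, y)

theorem tensor {F : X → V →ₗ[k] W} {F' : X → V' →ₗ[k] W'} (hF : IsEquivariant ρ σ F)
    (hF' : IsEquivariant ρ' σ' F') :
    IsEquivariant (ρ.tprod ρ') (σ.tprod σ') (fun x => TensorProduct.map (F x) (F' x)) :=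
  fun g x => by
    rw [Representation.tprod_apply, Representation.tprod_apply, ← TensorProduct.map_comp,
      ← TensorProduct.map_comp, hF, hF']

theorem comp_comp_inv {F : X → V →ₗ[k] W} (hF : IsEquivariant ρ σ F) (g : G) (x : X) :
    σ g ∘ₗ F (g⁻¹ • x) ∘ₗ ρ g⁻¹ = F x := by
  rw [← LinearMap.comp_assoc, ← hF, smul_inv_smul, LinearMap.comp_assoc,
    ← Module.End.mul_eq_comp (ρ g), ← map_mul, mul_inv_cancel, map_one]
  rfl

theorem apply_smul_one {F : X → k →ₗ[k] k}
    (hF : IsEquivariant (Representation.trivial k G k) (Representation.trivial k G k) F)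
    (g : G) (x : X) : F (g • x) 1 = F x 1 :=
  LinearMap.congr_fun (hF g x) 1

end IsEquivariant

section Trace

variable [Finite G]

/-- The trace of a family of linear maps: the sum of its conjugates under `G`. -/
noncomputable def familyTrace (ρ : Representation k G V) (σ : Representation k G W) :
    (X → V →ₗ[k] W) →ₗ[k] X → V →ₗ[k] W :=
  letI := Fintype.ofFinite G
  { toFun θ x := ∑ g : G, σ g ∘ₗ θ (g⁻¹ • x) ∘ₗ ρ g⁻¹
    map_add' θ η := by
      ext x : 1
      simp only [Pi.add_apply, LinearMap.add_comp, LinearMap.comp_add, Finset.sum_add_distrib]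
    map_smul' c θ := by
      ext x : 1
      simp only [Pi.smul_apply, LinearMap.smul_comp, LinearMap.comp_smul, Finset.smul_sum,
        RingHom.id_apply] }

theorem familyTrace_apply [hG : Fintype G] (θ : X → V →ₗ[k] W) (x : X) :
    familyTrace ρ σ θ x = ∑ g : G, σ g ∘ₗ θ (g⁻¹ • x) ∘ₗ ρ g⁻¹ := by
  rw [Subsingleton.elim hG (Fintype.ofFinite G)]
  rfl

theorem IsEquivariant.comp_familyTrace {E : X → W →ₗ[k] Z} (hE : IsEquivariant σ τ E)
    (θ : X → V →ₗ[k] W) (x : X) :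
    E x ∘ₗ familyTrace ρ σ θ x = familyTrace ρ τ (fun x => E x ∘ₗ θ x) x := by
  have := Fintype.ofFinite G
  rw [familyTrace_apply, familyTrace_apply, linearMap_comp_sum]
  refine Finset.sum_congr rfl fun g _ => ?_
  rw [LinearMap.comp_assoc, ← LinearMap.comp_assoc _ _ (τ g), ← hE, smul_inv_smul,
    LinearMap.comp_assoc]

theorem IsEquivariant.familyTrace_comp {F : X → V →ₗ[k] W} (hF : IsEquivariant ρ σ F)
    (θ : X → W →ₗ[k] Z) (x : X) :
    familyTrace σ τ θ x ∘ₗ F x = familyTrace ρ τ (fun x => θ x ∘ₗ F x) x := by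
  have := Fintype.ofFinite G
  rw [familyTrace_apply, familyTrace_apply, sum_linearMap_comp]
  refine Finset.sum_congr rfl fun g _ => ?_
  rw [LinearMap.comp_assoc, LinearMap.comp_assoc, LinearMap.comp_assoc, hF]

theorem familyTrace_pull (θ : X → V →ₗ[k] W) {φ : Y → X}
    (hφ : ∀ (g : G) y, φ (g • y) = g • φ y) (y : Y) :
    familyTrace ρ σ (fun y => θ (φ y)) y = familyTrace ρ σ θ (φ y) := by
  have := Fintype.ofFinite G
  simp only [familyTrace_apply, hφ]

theorem familyTrace_sum_fiber [Fintype Y] (θ : X × Y → V →ₗ[k] W) (x : X) :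
    familyTrace ρ σ (fun x => ∑ y, θ (x, y)) x = ∑ y, familyTrace ρ σ θ (x, y) := by
  have := Fintype.ofFinite G
  simp only [familyTrace_apply]
  rw [Finset.sum_comm]
  refine Finset.sum_congr rfl fun g _ => ?_
  rw [sum_linearMap_comp, linearMap_comp_sum]
  exact (Equiv.sum_comp (MulAction.toPerm g⁻¹)
    fun y => σ g ∘ₗ θ (g⁻¹ • x, y) ∘ₗ ρ g⁻¹).symm

theorem IsEquivariant.familyTrace_tensor {F : X → V →ₗ[k] W} (hF : IsEquivariant ρ σ F)
    (θ : X → V' →ₗ[k] W') (x : X) :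
    familyTrace (ρ.tprod ρ') (σ.tprod σ') (fun x => TensorProduct.map (F x) (θ x)) x =
      TensorProduct.map (F x) (familyTrace ρ' σ' θ x) := by
  have := Fintype.ofFinite G
  simp only [familyTrace_apply, Representation.tprod_apply, ← TensorProduct.map_comp,
    hF.comp_comp_inv]
  exact (map_sum (TensorProduct.mapBilinear _ _ _ _ _ (F x)) _ _).symm

theorem IsEquivariant.tensor_familyTrace {F : X → V' →ₗ[k] W'} (hF : IsEquivariant ρ' σ' F)
    (θ : X → V →ₗ[k] W) (x : X) :
    familyTrace (ρ.tprod ρ') (σ.tprod σ') (fun x => TensorProduct.map (θ x) (F x)) x =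
      TensorProduct.map (familyTrace ρ σ θ x) (F x) := by
  have := Fintype.ofFinite G
  simp only [familyTrace_apply, Representation.tprod_apply, ← TensorProduct.map_comp,
    hF.comp_comp_inv]
  exact (map_sum ((TensorProduct.mapBilinear _ _ _ _ _).flip (F x)) _ _).symm

theorem IsEquivariant.familyTrace_smul [Fintype G] {F : X → V →ₗ[k] W}
    (hF : IsEquivariant ρ σ F) (b : X → k) (x : X) :
    familyTrace ρ σ (fun x => b x • F x) x = (∑ g : G, b (g⁻¹ • x)) • F x := by
  simp only [familyTrace_apply, LinearMap.smul_comp, LinearMap.comp_smul, hF.comp_comp_inv,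
    Finset.sum_smul]

/-- Equality of families up to traces. Between equivariant families this is equality in the stable
category. -/
def StablyEq (ρ : Representation k G V) (σ : Representation k G W) (E F : X → V →ₗ[k] W) : Prop :=
  E - F ∈ LinearMap.range (familyTrace (X := X) ρ σ)

namespace StablyEq

theorem refl (F : X → V →ₗ[k] W) : StablyEq ρ σ F F := by
  rw [StablyEq, sub_self]
  exact zero_mem _

theorem symm {E F : X → V →ₗ[k] W} (h : StablyEq ρ σ E F) : StablyEq ρ σ F E := by
  rw [StablyEq, ← neg_sub]
  exact neg_mem h

theorem trans {D E F : X → V →ₗ[k] W} (h : StablyEq ρ σ D E) (h' : StablyEq ρ σ E F) :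
    StablyEq ρ σ D F := by
  rw [StablyEq, ← sub_add_sub_cancel]
  exact add_mem h h'

instance : Trans (StablyEq (X := X) ρ σ) (StablyEq ρ σ) (StablyEq ρ σ) := ⟨trans⟩

theorem comp_left {F F' : X → V →ₗ[k] W} (h : StablyEq ρ σ F F') {E : X → W →ₗ[k] Z}
    (hE : IsEquivariant σ τ E) :
    StablyEq ρ τ (fun x => E x ∘ₗ F x) (fun x => E x ∘ₗ F' x) := by
  obtain ⟨θ, hθ⟩ := h
  refine ⟨fun x => E x ∘ₗ θ x, funext fun x => ?_⟩
  rw [← hE.comp_familyTrace, hθ, Pi.sub_apply, Pi.sub_apply, LinearMap.comp_sub]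

theorem comp_right {E E' : X → W →ₗ[k] Z} (h : StablyEq σ τ E E') {F : X → V →ₗ[k] W}
    (hF : IsEquivariant ρ σ F) :
    StablyEq ρ τ (fun x => E x ∘ₗ F x) (fun x => E' x ∘ₗ F x) := by
  obtain ⟨θ, hθ⟩ := h
  refine ⟨fun x => θ x ∘ₗ F x, funext fun x => ?_⟩
  rw [← hF.familyTrace_comp, hθ, Pi.sub_apply, Pi.sub_apply, LinearMap.sub_comp]

theorem pull {E F : X → V →ₗ[k] W} (h : StablyEq ρ σ E F) {φ : Y → X}
    (hφ : ∀ (g : G) y, φ (g • y) = g • φ y) :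
    StablyEq ρ σ (fun y => E (φ y)) (fun y => F (φ y)) := by
  obtain ⟨θ, hθ⟩ := h
  refine ⟨fun y => θ (φ y), funext fun y => ?_⟩
  rw [familyTrace_pull θ hφ, hθ, Pi.sub_apply, Pi.sub_apply]

theorem const_smul {E F : X → V →ₗ[k] W} (h : StablyEq ρ σ E F) (c : k) :
    StablyEq ρ σ (fun x => c • E x) (fun x => c • F x) := by
  rw [StablyEq, show (fun x => c • E x) - (fun x => c • F x) = c • (E - F) from
    (smul_sub c E F).symm]
  exact Submodule.smul_mem _ c h

theorem sum_fiber [Fintype Y] {E F : X × Y → V →ₗ[k] W} (h : StablyEq ρ σ E F) :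
    StablyEq ρ σ (fun x => ∑ y, E (x, y)) (fun x => ∑ y, F (x, y)) := by
  obtain ⟨θ, hθ⟩ := h
  refine ⟨fun x => ∑ y, θ (x, y), funext fun x => ?_⟩
  simp only [familyTrace_sum_fiber, hθ, Pi.sub_apply, Finset.sum_sub_distrib]

theorem tensor_left {F : X → V →ₗ[k] W} (hF : IsEquivariant ρ σ F) {E E' : X → V' →ₗ[k] W'}
    (h : StablyEq ρ' σ' E E') :
    StablyEq (ρ.tprod ρ') (σ.tprod σ') (fun x => TensorProduct.map (F x) (E x))
      (fun x => TensorProduct.map (F x) (E' x)) := by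
  obtain ⟨θ, hθ⟩ := h
  refine ⟨fun x => TensorProduct.map (F x) (θ x), funext fun x => ?_⟩
  rw [hF.familyTrace_tensor, hθ]
  exact map_sub (TensorProduct.mapBilinear _ _ _ _ _ (F x)) _ _

theorem tensor_right {E E' : X → V →ₗ[k] W} (h : StablyEq ρ σ E E') {F : X → V' →ₗ[k] W'}
    (hF : IsEquivariant ρ' σ' F) :
    StablyEq (ρ.tprod ρ') (σ.tprod σ') (fun x => TensorProduct.map (E x) (F x))
      (fun x => TensorProduct.map (E' x) (F x)) := by
  obtain ⟨θ, hθ⟩ := h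
  refine ⟨fun x => TensorProduct.map (θ x) (F x), funext fun x => ?_⟩
  rw [hF.tensor_familyTrace, hθ]
  exact map_sub ((TensorProduct.mapBilinear _ _ _ _ _).flip (F x)) _ _

end StablyEq

end Trace

section OrbitSums

theorem card_stabilizer_smul (g : G) (x : X) :
    Nat.card (MulAction.stabilizer G (g • x)) = Nat.card (MulAction.stabilizer G x) :=
  Nat.card_congr (MulAction.stabilizerEquivStabilizer rfl).symm.toEquiv

variable {M : Type*} [Fintype G]

open Classical in
theorem sum_ite_inv_smul_eq [AddCommMonoid M] {x y : X} (h : y ∈ MulAction.orbit G x) (c : M) :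
    ∑ g : G, (if g⁻¹ • x = y then c else 0) = Nat.card (MulAction.stabilizer G x) • c := by
  obtain ⟨h, rfl⟩ := h
  rw [← Finset.sum_filter, Finset.sum_const, ← Fintype.card_subtype, ← Nat.card_eq_fintype_card]
  congr 1
  refine Nat.card_congr (((Equiv.mulRight h).trans (Equiv.inv G)).subtypeEquiv fun g => ?_)
  simp [MulAction.mem_stabilizer_iff, mul_smul, inv_smul_eq_iff]

theorem sum_inv_smul_eq_zero (f : X → k) {x : X}
    (hx : (Nat.card (MulAction.stabilizer G x) : k) = 0) : ∑ g : G, f (g⁻¹ • x) = 0 := by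
  classical
  let orbit : Finset X := Finset.univ.image fun g : G => g • x
  have expand (g : G) : f (g⁻¹ • x) = ∑ y ∈ orbit, if g⁻¹ • x = y then f y else 0 := by
    rw [Finset.sum_ite_eq, if_pos (Finset.mem_image_of_mem _ (Finset.mem_univ _))]
  simp only [expand]
  rw [Finset.sum_comm]
  refine Finset.sum_eq_zero fun y hy => ?_
  obtain ⟨g, -, hg⟩ := Finset.mem_image.mp hy
  rw [sum_ite_inv_smul_eq ⟨g, hg⟩, nsmul_eq_mul, hx, zero_mul]

theorem exists_sum_inv_smul_eq {k : Type*} [Field k] {a : X → k}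
    (ha : ∀ (g : G) x, a (g • x) = a x)
    (ha₀ : ∀ x, (Nat.card (MulAction.stabilizer G x) : k) = 0 → a x = 0) :
    ∃ b : X → k, ∀ x, ∑ g : G, b (g⁻¹ • x) = a x := by
  classical
  let rep (x : X) : X := (Quotient.mk (MulAction.orbitRel G X) x).out
  have rep_smul (g : G) (x : X) : rep (g • x) = rep x :=
    congrArg Quotient.out (Quotient.sound ⟨g, rfl⟩)
  have rep_mem (x : X) : rep x ∈ MulAction.orbit G x :=
    Quotient.mk_out (s := MulAction.orbitRel G X) x
  refine ⟨fun y => if y = rep y then a y / Nat.card (MulAction.stabilizer G y) else 0,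
    fun x => ?_⟩
  simp only [rep_smul, ha, card_stabilizer_smul]
  rw [sum_ite_inv_smul_eq (rep_mem x), nsmul_eq_mul]
  by_cases hx : (Nat.card (MulAction.stabilizer G x) : k) = 0
  · rw [hx, zero_mul, ha₀ x hx]
  · rw [mul_div_cancel₀ _ hx]

end OrbitSums

end Families

section StableInverse

variable {k G X Y V W Z V' W' : Type*} [Field k] [Group G] [MulAction G X]
  [MulAction G Y]
  [AddCommGroup V] [Module k V] [AddCommGroup W] [Module k W] [AddCommGroup Z] [Module k Z]
  [AddCommGroup V'] [Module k V'] [AddCommGroup W'] [Module k W']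
  {ρ : Representation k G V} {σ : Representation k G W} {τ : Representation k G Z}
  {ρ' : Representation k G V'} {σ' : Representation k G W'}

section Average

variable {ι : Type*} [Finite ι]

/-- The average of a family over a finite index set. It is only meaningful when the cardinality
of the index set is nonzero in `k`. -/
noncomputable def average (F : ι → V →ₗ[k] W) : V →ₗ[k] W :=
  letI := Fintype.ofFinite ι
  (Nat.card ι : k)⁻¹ • ∑ i, F i

theorem average_const (hι : (Nat.card ι : k) ≠ 0) (E : V →ₗ[k] W) :
    average (fun _ : ι => E) = E := by
  let _ := Fintype.ofFinite ι
  rw [average, Finset.sum_const, Finset.card_univ, ← Nat.card_eq_fintype_card,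
    ← Nat.cast_smul_eq_nsmul k, inv_smul_smul₀ hι]

end Average

theorem IsEquivariant.average [Finite X] {F : X → V →ₗ[k] W} (hF : IsEquivariant ρ σ F) :
    IsEquivariant ρ σ (fun _ : Y => average F) :=
  letI := Fintype.ofFinite X
  (hF.pull (φ := (Prod.snd : Y × X → X)) fun _ _ => rfl).sum_fiber.smul fun _ _ => rfl

variable [Finite G]

theorem IsEquivariant.smul_stablyEq_smul {F : X → V →ₗ[k] W} (hF : IsEquivariant ρ σ F)
    {a b : X → k} (ha : ∀ (g : G) x, a (g • x) = a x) (hb : ∀ (g : G) x, b (g • x) = b x)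
    (hab : ∀ x, (Nat.card (MulAction.stabilizer G x) : k) = 0 → a x = b x) :
    StablyEq ρ σ (fun x => a x • F x) (fun x => b x • F x) := by
  have := Fintype.ofFinite G
  obtain ⟨c, hc⟩ := exists_sum_inv_smul_eq (a := fun x => a x - b x)
    (fun g x => by rw [ha, hb]) fun x hx => sub_eq_zero.mpr (hab x hx)
  refine ⟨fun x => c x • F x, funext fun x => ?_⟩
  rw [hF.familyTrace_smul, hc, sub_smul, Pi.sub_apply]

theorem stablyEq_trivial_iff {E F : X → k →ₗ[k] k}
    (hE : IsEquivariant (Representation.trivial k G k) (Representation.trivial k G k) E)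
    (hF : IsEquivariant (Representation.trivial k G k) (Representation.trivial k G k) F) :
    StablyEq (Representation.trivial k G k) (Representation.trivial k G k) E F ↔
      ∀ x, (Nat.card (MulAction.stabilizer G x) : k) = 0 → E x 1 = F x 1 := by
  constructor
  · rintro ⟨θ, hθ⟩ x hx
    have := Fintype.ofFinite G
    have trace_eq_zero : familyTrace (Representation.trivial k G k)
        (Representation.trivial k G k) θ x 1 = 0 := by
      rw [familyTrace_apply, LinearMap.sum_apply]
      exact sum_inv_smul_eq_zero (fun y => θ y 1) hx
    rw [← sub_eq_zero, ← LinearMap.sub_apply, ← Pi.sub_apply, ← hθ, trace_eq_zero]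
  · intro h
    convert IsEquivariant.id.smul_stablyEq_smul hE.apply_smul_one hF.apply_smul_one h <;>
      exact LinearMap.ext_ring (by simp)

namespace StablyEq

theorem average_fiber [Finite X] {E F : Y × X → V →ₗ[k] W} (h : StablyEq ρ σ E F) :
    StablyEq ρ σ (fun y => average fun x => E (y, x)) (fun y => average fun x => F (y, x)) :=
  letI := Fintype.ofFinite X
  h.sum_fiber.const_smul _

theorem of_const [Finite X] (hX : (Nat.card X : k) ≠ 0) {E F : V →ₗ[k] W}
    (h : StablyEq ρ σ (fun _ : X => E) (fun _ : X => F)) :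
    StablyEq ρ σ (fun _ : Y => E) (fun _ : Y => F) := by
  simpa only [average_const hX] using
    (h.pull (φ := (Prod.snd : Y × X → X)) fun _ _ => rfl).average_fiber

theorem average [Finite X] (hX : (Nat.card X : k) ≠ 0) {F : X → V →ₗ[k] W}
    (h : StablyEq ρ σ (fun x : X × X => F x.1) (fun x => F x.2)) :
    StablyEq ρ σ F (fun _ => average F) := by
  simpa only [average_const hX] using h.average_fiber

end StablyEq

/-- Two equivariant families of linear maps that are inverse to each other up to traces, that is,
representatives of mutually inverse stable isomorphisms. -/
structure StablyInverse (ρ : Representation k G V) (σ : Representation k G W)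
    (F : X → V →ₗ[k] W) (S : X → W →ₗ[k] V) : Prop where
  left : IsEquivariant ρ σ F
  right : IsEquivariant σ ρ S
  right_left : StablyEq ρ ρ (fun x => S x ∘ₗ F x) (fun _ => LinearMap.id)
  left_right : StablyEq σ σ (fun x => F x ∘ₗ S x) (fun _ => LinearMap.id)

namespace StablyInverse

variable {F : X → V →ₗ[k] W} {S : X → W →ₗ[k] V}

theorem symm (h : StablyInverse ρ σ F S) : StablyInverse σ ρ S F :=
  ⟨h.right, h.left, h.left_right, h.right_left⟩

theorem pull (h : StablyInverse ρ σ F S) {φ : Y → X} (hφ : ∀ (g : G) y, φ (g • y) = g • φ y) :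
    StablyInverse ρ σ (fun y => F (φ y)) (fun y => S (φ y)) :=
  ⟨h.left.pull hφ, h.right.pull hφ, h.right_left.pull hφ, h.left_right.pull hφ⟩

theorem comp (h : StablyInverse ρ σ F S) {E : X → W →ₗ[k] Z} {T : X → Z →ₗ[k] W}
    (h' : StablyInverse σ τ E T) :
    StablyInverse ρ τ (fun x => E x ∘ₗ F x) (fun x => S x ∘ₗ T x) where
  left := h'.left.comp h.left
  right := h.right.comp h'.right
  right_left := ((h'.right_left.comp_right h.left).comp_left h.right).trans h.right_left
  left_right := ((h.left_right.comp_right h'.right).comp_left h'.left).trans h'.left_right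

theorem tensor (h : StablyInverse ρ σ F S) {F' : X → V' →ₗ[k] W'} {S' : X → W' →ₗ[k] V'}
    (h' : StablyInverse ρ' σ' F' S') :
    StablyInverse (ρ.tprod ρ') (σ.tprod σ') (fun x => TensorProduct.map (F x) (F' x))
      (fun x => TensorProduct.map (S x) (S' x)) where
  left := h.left.tensor h'.left
  right := h.right.tensor h'.right
  right_left := by
    simpa only [TensorProduct.map_comp, TensorProduct.map_id] using
      (h.right_left.tensor_right (h'.right.comp h'.left)).trans
        (.tensor_left .id h'.right_left)
  left_right := by
    simpa only [TensorProduct.map_comp, TensorProduct.map_id] using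
      (h.left_right.tensor_right (h'.left.comp h'.right)).trans
        (.tensor_left .id h'.left_right)

theorem stablyEq_right {F' : X → V →ₗ[k] W} {S' : X → W →ₗ[k] V} (h : StablyInverse ρ σ F S)
    (h' : StablyInverse ρ σ F' S') (hF : StablyEq ρ σ F F') : StablyEq σ ρ S S' :=
  calc StablyEq σ ρ S (fun x => S x ∘ₗ F' x ∘ₗ S' x) :=
        (h'.left_right.comp_left h.right).symm
    StablyEq σ ρ _ (fun x => S x ∘ₗ F x ∘ₗ S' x) :=
        ((hF.comp_right h'.right).comp_left h.right).symm
    StablyEq σ ρ _ S' := h.right_left.comp_right h'.right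

theorem average [Finite X] (hX : (Nat.card X : k) ≠ 0) (h : StablyInverse ρ σ F S)
    (hF : StablyEq ρ σ (fun x : X × X => F x.1) (fun x => F x.2)) :
    StablyInverse ρ σ (fun _ : Y => average F) (fun _ : Y => average S) := by
  have hS : StablyEq σ ρ (fun x : X × X => S x.1) (fun x => S x.2) :=
    (h.pull fun _ _ => rfl).stablyEq_right (h.pull fun _ _ => rfl) hF
  have avgF := hF.average hX
  have avgS := hS.average hX
  refine ⟨h.left.average, h.right.average, .of_const hX ?_, .of_const hX ?_⟩
  · exact ((avgF.comp_left h.right).trans (avgS.comp_right h.left.average)).symm.trans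
      h.right_left
  · exact ((avgS.comp_left h.left).trans (avgF.comp_right h.right.average)).symm.trans
      h.left_right

section Trivial

variable {F : X → V →ₗ[k] k} {S : X → k →ₗ[k] V}

theorem apply_apply_one (h : StablyInverse ρ (Representation.trivial k G k) F S) {x : X}
    (hx : (Nat.card (MulAction.stabilizer G x) : k) = 0) : F x (S x 1) = 1 :=
  (stablyEq_trivial_iff (h.left.comp h.right) .id).mp h.left_right x hx

theorem stablyEq_of_apply_apply_one (h : StablyInverse ρ (Representation.trivial k G k) F S)
    (h₁ : ∀ x : X × X, (Nat.card (MulAction.stabilizer G x) : k) = 0 → F x.1 (S x.2 1) = 1) :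
    StablyEq ρ (Representation.trivial k G k) (fun x : X × X => F x.1) (fun x => F x.2) := by
  have fst := h.pull (φ := (Prod.fst : X × X → X)) fun _ _ => rfl
  have snd := h.pull (φ := (Prod.snd : X × X → X)) fun _ _ => rfl
  have transition_eq := (stablyEq_trivial_iff (fst.left.comp snd.right) .id).mpr h₁
  exact (snd.right_left.comp_left fst.left).symm.trans (transition_eq.comp_right snd.left)

end Trivial

end StablyInverse

end StableInverse

section Idempotents

theorem exists_isIdempotentElem_dvd_sub {R : Type*} [CommRing R] [IsArtinianRing R] (a : R) :
    ∃ e : R, IsIdempotentElem e ∧ a * a - a ∣ e - a := by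
  obtain ⟨n, y, hy⟩ := IsArtinian.exists_pow_succ_smul_dvd a (1 : R)
  have absorb : a ^ (n + 1) * (a * y) = a ^ (n + 1) := by
    rw [smul_eq_mul, smul_eq_mul, mul_one] at hy
    rw [mul_left_comm, hy, ← pow_succ']
  have absorb_pow (m : ℕ) : a ^ (n + 1) * (a * y) ^ m = a ^ (n + 1) := by
    induction m with
    | zero => rw [pow_zero, mul_one]
    | succ m ih => rw [pow_succ (a * y), ← mul_assoc, ih, absorb]
  refine ⟨(a * y) ^ (n + 1), ?_, ?_⟩
  · rw [IsIdempotentElem]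
    nth_rw 1 [mul_pow]
    rw [mul_right_comm, absorb_pow, ← mul_pow]
  · let q := Ideal.Quotient.mk (Ideal.span {a * a - a})
    have idem : IsIdempotentElem (q a) := by
      rw [IsIdempotentElem, ← map_mul, Ideal.Quotient.eq]
      exact Ideal.mem_span_singleton_self _
    rw [← Ideal.mem_span_singleton, ← Ideal.Quotient.eq]
    change q ((a * y) ^ (n + 1)) = q a
    have absorb_q : q a * q y = q a := by
      have := congrArg q absorb
      rwa [map_mul, map_mul, map_pow, idem.pow_succ_eq, ← mul_assoc, idem.eq] at this
    rw [map_pow, map_mul, absorb_q, idem.pow_succ_eq]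

theorem exists_isIdempotentElem_mem_adjoin {k A : Type*} [Field k] [Ring A] [Algebra k A]
    [FiniteDimensional k A] (a : A) :
    ∃ e ∈ Algebra.adjoin k {a}, ∃ c ∈ Algebra.adjoin k {a},
      IsIdempotentElem e ∧ e - a = c * (a * a - a) := by
  have : IsArtinianRing (Algebra.adjoin k {a}) := IsArtinianRing.of_finite k _
  obtain ⟨e, he, c, hc⟩ := exists_isIdempotentElem_dvd_sub
    (⟨a, Algebra.self_mem_adjoin_singleton k a⟩ : Algebra.adjoin k {a})
  exact ⟨e, e.2, c, c.2, congrArg Subtype.val he,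
    congrArg Subtype.val (hc.trans (mul_comm _ _))⟩

variable {k G V : Type*} [Field k] [Group G] [AddCommGroup V] [Module k V]
  [FiniteDimensional k V] {ρ : Representation k G V}

theorem exists_retract {e : Module.End k V} (he : IsIdempotentElem e) :
    ∃ (d : ℕ) (i : (Fin d → k) →ₗ[k] V) (π : V →ₗ[k] (Fin d → k)),
      i ∘ₗ π = e ∧ π ∘ₗ i = LinearMap.id := by
  let φ := (Module.finBasis k (LinearMap.range e)).equivFun
  refine ⟨_, (LinearMap.range e).subtype ∘ₗ φ.symm.toLinearMap,
    φ.toLinearMap ∘ₗ e.rangeRestrict, LinearMap.ext fun v => by simp,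
    LinearMap.ext fun w => φ.symm.injective (Subtype.ext ?_)⟩
  obtain ⟨v, hv⟩ := (φ.symm w).2
  simp only [LinearMap.comp_apply, LinearEquiv.coe_coe, LinearEquiv.symm_apply_apply,
    Submodule.subtype_apply, LinearMap.codRestrict_apply, LinearMap.id_apply]
  rw [← hv]
  exact LinearMap.congr_fun he v

theorem exists_equivariant_retract {e : Module.End k V} (he : IsIdempotentElem e)
    (hρ : ∀ g, Commute e (ρ g)) :
    ∃ (d : ℕ) (σ : Representation k G (Fin d → k)) (i : (Fin d → k) →ₗ[k] V)
      (π : V →ₗ[k] (Fin d → k)), (∀ g, i ∘ₗ σ g = ρ g ∘ₗ i) ∧ (∀ g, π ∘ₗ ρ g = σ g ∘ₗ π) ∧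
        π ∘ₗ i = LinearMap.id ∧ i ∘ₗ π = e := by
  obtain ⟨d, i, π, rfl, π_i⟩ := exists_retract he
  have i_equivariant (g : G) : i ∘ₗ π ∘ₗ ρ g ∘ₗ i = ρ g ∘ₗ i :=
    calc i ∘ₗ π ∘ₗ ρ g ∘ₗ i = ((i ∘ₗ π) ∘ₗ ρ g) ∘ₗ i := rfl
      _ = (ρ g ∘ₗ i ∘ₗ π) ∘ₗ i := congrArg (· ∘ₗ i) (hρ g)
      _ = ρ g ∘ₗ i ∘ₗ π ∘ₗ i := rfl
      _ = ρ g ∘ₗ i := by rw [π_i, LinearMap.comp_id]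
  have π_equivariant (g : G) : π ∘ₗ ρ g = (π ∘ₗ ρ g ∘ₗ i) ∘ₗ π :=
    calc π ∘ₗ ρ g = (π ∘ₗ i) ∘ₗ π ∘ₗ ρ g := by rw [π_i, LinearMap.id_comp]
      _ = π ∘ₗ (i ∘ₗ π) ∘ₗ ρ g := rfl
      _ = π ∘ₗ ρ g ∘ₗ i ∘ₗ π := congrArg (π ∘ₗ ·) (hρ g)
  let σ : Representation k G (Fin d → k) :=
    { toFun g := π ∘ₗ ρ g ∘ₗ i
      map_one' := by
        rw [map_one]
        exact π_i
      map_mul' g h := by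
        rw [map_mul]
        exact congrArg (π ∘ₗ ρ g ∘ₗ ·) (i_equivariant h).symm }
  exact ⟨d, σ, i, π, i_equivariant, π_equivariant, π_i, rfl⟩

theorem exists_equivariant_retract_stablyEq [Finite G] {X : Type*} [MulAction G X]
    {a : Module.End k V} (hρ : ∀ g, Commute a (ρ g))
    (ha : StablyEq ρ ρ (fun _ : X => a ∘ₗ a) (fun _ => a)) :
    ∃ (d : ℕ) (σ : Representation k G (Fin d → k)) (i : (Fin d → k) →ₗ[k] V)
      (π : V →ₗ[k] (Fin d → k)), (∀ g, i ∘ₗ σ g = ρ g ∘ₗ i) ∧ (∀ g, π ∘ₗ ρ g = σ g ∘ₗ π) ∧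
        π ∘ₗ i = LinearMap.id ∧ StablyEq ρ ρ (fun _ : X => i ∘ₗ π) (fun _ => a) := by
  have commute_of_mem {b : Module.End k V} (hb : b ∈ Algebra.adjoin k {a}) (g : G) :
      Commute b (ρ g) :=
    (Algebra.commute_of_mem_adjoin_singleton_of_commute hb (hρ g).symm).symm
  obtain ⟨e, e_mem, c, c_mem, he, hec⟩ := exists_isIdempotentElem_mem_adjoin (k := k) a
  obtain ⟨d, σ, i, π, hi, hπ, π_i, i_π⟩ := exists_equivariant_retract he (commute_of_mem e_mem)
  refine ⟨d, σ, i, π, hi, hπ, π_i, ?_⟩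
  obtain ⟨θ, hθ⟩ := ha.comp_left (E := fun _ => c) fun g _ => commute_of_mem c_mem g
  refine ⟨θ, hθ.trans (funext fun _ => ?_)⟩
  rw [i_π]
  exact ((mul_sub c _ _).symm.trans hec.symm)

end Idempotents

section EffectiveDescent

/-- The permutation representation of `G` on the `k`-valued functions on a `G`-set. -/
def funRep (k G X : Type*) [CommRing k] [Group G] [MulAction G X] :
    Representation k G (X → k) where
  toFun g := LinearMap.funLeft k k fun x => g⁻¹ • x
  map_one' := by
    ext f x
    simp
  map_mul' g h := by
    ext f x
    simp [mul_smul, LinearMap.funLeft_apply]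

theorem isEquivariant_proj {k G X : Type*} [CommRing k] [Group G] [MulAction G X] :
    IsEquivariant (funRep k G X) (Representation.trivial k G k) (fun x : X => LinearMap.proj x) :=
  fun g x => by
    ext f
    simp [funRep, LinearMap.funLeft_apply]

theorem isEquivariant_single {k G X : Type*} [CommRing k] [Group G] [MulAction G X]
    [DecidableEq X] : IsEquivariant (Representation.trivial k G k) (funRep k G X)
      (fun x : X => LinearMap.single k (fun _ => k) x) := fun g x => by
  refine LinearMap.ext_ring (funext fun y => ?_)
  simp [funRep, LinearMap.funLeft_apply, Pi.single_apply, inv_smul_eq_iff]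

/-- A descent datum on the constant one-dimensional representation of a `G`-set `X`, given by the
scalars by which it acts: invertibility and the cocycle condition are only visible at the points
whose stabilizer has order zero in `k`. -/
structure IsStableCocycle (k G : Type*) {X : Type*} [Field k] [Group G] [MulAction G X]
    (c : X → X → k) : Prop where
  smul (g : G) (x y : X) : c (g • x) (g • y) = c x y
  mul (x y z : X) (h : (Nat.card (MulAction.stabilizer G (x, y, z)) : k) = 0) :
    c x y * c y z = c x z
  one (x : X) (h : (Nat.card (MulAction.stabilizer G x) : k) = 0) : c x x = 1

variable {k G X : Type*} [Field k] [Group G] [MulAction G X] {c : X → X → k}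

theorem IsStableCocycle.smul_id_self [Finite G] (hc : IsStableCocycle k G c) :
    StablyEq (Representation.trivial k G k) (Representation.trivial k G k)
      (fun x : X => c x x • LinearMap.id) (fun _ => LinearMap.id) := by
  convert IsEquivariant.id.smul_stablyEq_smul (a := fun x => c x x) (b := fun _ => (1 : k))
    (fun g x => hc.smul g x x) (fun _ _ => rfl) hc.one using 2
  exact (one_smul k _).symm

variable [Finite X]

/-- The map from functions on `X` to the fibre at `x` which transports all values to `x` along
the descent datum `c` and adds them up. -/
noncomputable def cocycleProj (c : X → X → k) (x : X) : (X → k) →ₗ[k] k :=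
  letI := Fintype.ofFinite X
  ∑ y, c x y • LinearMap.proj y

/-- The map from the fibre at `x` to functions on `X` which transports a value along the descent
datum `c` to all points, normalized such that it is a stable section of `cocycleProj`. -/
noncomputable def cocycleSingle [DecidableEq X] (c : X → X → k) (x : X) : k →ₗ[k] X → k :=
  average fun y => c y x • LinearMap.single k (fun _ => k) y

/-- The endomorphism of the functions on `X` whose image is the module defined by the descent
datum `c`; it is idempotent only up to traces. -/
noncomputable def cocycleOperator [DecidableEq X] (c : X → X → k) : (X → k) →ₗ[k] X → k :=
  average fun y => LinearMap.single k (fun _ => k) y ∘ₗ cocycleProj c y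

theorem cocycleProj_comp_single [DecidableEq X] (c : X → X → k) (x y : X) :
    cocycleProj c x ∘ₗ LinearMap.single k (fun _ => k) y = c x y • LinearMap.id :=
  letI := Fintype.ofFinite X
  LinearMap.ext_ring (by simp [cocycleProj, Pi.single_apply])

namespace IsStableCocycle

theorem isEquivariant_cocycleProj (hc : IsStableCocycle k G c) :
    IsEquivariant (funRep k G X) (Representation.trivial k G k) (cocycleProj c) :=
  letI := Fintype.ofFinite X
  ((isEquivariant_proj.pull (φ := (Prod.snd : X × X → X)) fun _ _ => rfl).smul
    (a := fun x => c x.1 x.2) fun g x => hc.smul g x.1 x.2).sum_fiber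

theorem smul_cocycleProj [Finite G] (hc : IsStableCocycle k G c) :
    StablyEq (funRep k G X) (Representation.trivial k G k)
      (fun x : X × X => c x.2 x.1 • cocycleProj c x.1) (fun x => cocycleProj c x.2) := by
  let _ := Fintype.ofFinite X
  simp only [cocycleProj, Finset.smul_sum, smul_smul]
  refine ((isEquivariant_proj.pull (φ := (Prod.snd : (X × X) × X → X)) fun _ _ =>
    rfl).smul_stablyEq_smul (a := fun x => c x.1.2 x.1.1 * c x.1.1 x.2)
    (b := fun x => c x.1.2 x.2) (fun g x => ?_) (fun g x => hc.smul g x.1.2 x.2)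
    fun x hx => ?_).sum_fiber
  · exact congrArg₂ (· * ·) (hc.smul g x.1.2 x.1.1) (hc.smul g x.1.1 x.2)
  · refine hc.mul _ _ _ ?_
    convert hx using 4
    ext g
    simp [MulAction.mem_stabilizer_iff, Prod.ext_iff, and_left_comm, and_assoc]

variable [DecidableEq X]

theorem isEquivariant_cocycleSingle (hc : IsStableCocycle k G c) :
    IsEquivariant (Representation.trivial k G k) (funRep k G X) (cocycleSingle c) :=
  letI := Fintype.ofFinite X
  ((isEquivariant_single.pull (φ := (Prod.snd : X × X → X)) fun _ _ => rfl).smul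
    (a := fun x => c x.2 x.1) fun g x => hc.smul g x.2 x.1).sum_fiber.smul fun _ _ => rfl

theorem isEquivariant_cocycleOperator (hc : IsStableCocycle k G c) {Y : Type*} [MulAction G Y] :
    IsEquivariant (funRep k G X) (funRep k G X) (fun _ : Y => cocycleOperator c) :=
  (isEquivariant_single.comp hc.isEquivariant_cocycleProj).average

variable [Finite G]

theorem cocycleSingle_comp_cocycleProj (hc : IsStableCocycle k G c) :
    StablyEq (funRep k G X) (funRep k G X) (fun x => cocycleSingle c x ∘ₗ cocycleProj c x)
      (fun _ => cocycleOperator c) := by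
  convert (hc.smul_cocycleProj.comp_left
    (isEquivariant_single.pull (φ := (Prod.snd : X × X → X)) fun _ _ =>
      rfl)).average_fiber using 2 with x
  · simp only [cocycleSingle, average, sum_linearMap_comp, LinearMap.smul_comp, LinearMap.comp_smul]
  · rfl

theorem cocycleProj_comp_cocycleSingle (hX : (Nat.card X : k) ≠ 0) (hc : IsStableCocycle k G c) :
    StablyEq (Representation.trivial k G k) (Representation.trivial k G k)
      (fun x : X × X => cocycleProj c x.1 ∘ₗ cocycleSingle c x.2)
      (fun x => c x.1 x.2 • LinearMap.id) := by
  have transport : StablyEq (Representation.trivial k G k) (Representation.trivial k G k)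
      (fun x : (X × X) × X => (c x.1.1 x.2 * c x.2 x.1.2) • LinearMap.id)
      (fun x => c x.1.1 x.1.2 • LinearMap.id) := by
    refine IsEquivariant.id.smul_stablyEq_smul (fun g x => ?_) (fun g x => hc.smul g x.1.1 x.1.2)
      fun x hx => hc.mul _ _ _ ?_
    · exact congrArg₂ (· * ·) (hc.smul g x.1.1 x.2) (hc.smul g x.2 x.1.2)
    · convert hx using 4
      ext g
      simp [MulAction.mem_stabilizer_iff, Prod.ext_iff, and_left_comm, and_comm]
  convert transport.average_fiber using 2 with x x
  · simp only [cocycleSingle, average, LinearMap.comp_smul, linearMap_comp_sum,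
      cocycleProj_comp_single, smul_smul, mul_comm]
  · exact (average_const hX _).symm

theorem cocycleProj_comp_cocycleSingle_self (hX : (Nat.card X : k) ≠ 0)
    (hc : IsStableCocycle k G c) :
    StablyEq (Representation.trivial k G k) (Representation.trivial k G k)
      (fun x : X => cocycleProj c x ∘ₗ cocycleSingle c x) (fun _ => LinearMap.id) :=
  ((hc.cocycleProj_comp_cocycleSingle hX).pull (φ := fun x : X => (x, x))
    fun _ _ => rfl).trans hc.smul_id_self

theorem cocycleOperator_comp_self (hX : (Nat.card X : k) ≠ 0) (hc : IsStableCocycle k G c) :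
    StablyEq (funRep k G X) (funRep k G X)
      (fun _ : X => cocycleOperator c ∘ₗ cocycleOperator c) (fun _ => cocycleOperator c) := by
  have hP := hc.isEquivariant_cocycleProj
  have hT := hc.isEquivariant_cocycleSingle
  have operator := hc.cocycleSingle_comp_cocycleProj
  calc StablyEq (funRep k G X) (funRep k G X)
        (fun _ : X => cocycleOperator c ∘ₗ cocycleOperator c)
        (fun x => cocycleOperator c ∘ₗ cocycleSingle c x ∘ₗ cocycleProj c x) :=
      (operator.comp_left hc.isEquivariant_cocycleOperator).symm
    StablyEq (funRep k G X) (funRep k G X) _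
        (fun x => (cocycleSingle c x ∘ₗ cocycleProj c x) ∘ₗ
          cocycleSingle c x ∘ₗ cocycleProj c x) :=
      (operator.comp_right (hT.comp hP)).symm
    StablyEq (funRep k G X) (funRep k G X) _ (fun x => cocycleSingle c x ∘ₗ cocycleProj c x) :=
      ((hc.cocycleProj_comp_cocycleSingle_self hX).comp_right hP).comp_left hT
    StablyEq (funRep k G X) (funRep k G X) _ (fun _ => cocycleOperator c) := operator

end IsStableCocycle

/-- The representation is the image of an honest idempotent stably equal to `cocycleOperator c`. -/
theorem exists_stablyInverse_of_cocycle [Finite G] (hX : (Nat.card X : k) ≠ 0)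
    (hc : IsStableCocycle k G c) :
    ∃ (d : ℕ) (ρ : Representation k G (Fin d → k)) (F : X → (Fin d → k) →ₗ[k] k)
      (S : X → k →ₗ[k] Fin d → k), StablyInverse ρ (Representation.trivial k G k) F S ∧
      ∀ x : X × X, (Nat.card (MulAction.stabilizer G x) : k) = 0 →
        F x.1 (S x.2 1) = c x.1 x.2 := by
  classical
  have hP := hc.isEquivariant_cocycleProj
  have hT := hc.isEquivariant_cocycleSingle
  obtain ⟨d, ρ, i, π, hi, hπ, π_i, i_π⟩ := exists_equivariant_retract_stablyEq
    (hc.isEquivariant_cocycleOperator · PUnit.unit.{1})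
    (hc.cocycleOperator_comp_self hX)
  have hi : IsEquivariant ρ (funRep k G X) (fun _ : X => i) := fun g _ => hi g
  have hπ : IsEquivariant (funRep k G X) ρ (fun _ : X => π) := fun g _ => hπ g
  have i_π := i_π.trans hc.cocycleSingle_comp_cocycleProj.symm
  let F (x : X) := cocycleProj c x ∘ₗ i
  let S (x : X) := π ∘ₗ cocycleSingle c x
  have hF : IsEquivariant ρ (Representation.trivial k G k) F := hP.comp hi
  have hS : IsEquivariant (Representation.trivial k G k) ρ S := hπ.comp hT
  have S_F : StablyEq ρ ρ (fun x => S x ∘ₗ F x) (fun _ => LinearMap.id) := by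
    have h := (i_π.symm.comp_right hi).comp_left hπ
    have π_i_π_i : π ∘ₗ (i ∘ₗ π) ∘ₗ i = LinearMap.id := by
      rw [LinearMap.comp_assoc, π_i, LinearMap.comp_id, π_i]
    rwa [π_i_π_i] at h
  have F_S : StablyEq (Representation.trivial k G k) (Representation.trivial k G k)
      (fun x : X × X => F x.1 ∘ₗ S x.2) (fun x => c x.1 x.2 • LinearMap.id) := by
    have hP₁ := hP.pull (φ := (Prod.fst : X × X → X)) fun _ _ => rfl
    have hT₂ := hT.pull (φ := (Prod.snd : X × X → X)) fun _ _ => rfl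
    have i_π₂ := i_π.pull (φ := (Prod.snd : X × X → X)) fun _ _ => rfl
    have self₂ := (hc.cocycleProj_comp_cocycleSingle_self hX).pull
      (φ := (Prod.snd : X × X → X)) fun _ _ => rfl
    exact ((i_π₂.comp_right hT₂).comp_left hP₁).trans <|
      (self₂.comp_left (hP₁.comp hT₂)).trans <| hc.cocycleProj_comp_cocycleSingle hX
  refine ⟨d, ρ, F, S, ⟨hF, hS, S_F, ?_⟩, fun x hx => ?_⟩
  · exact (F_S.pull (φ := fun x : X => (x, x)) fun _ _ => rfl).trans hc.smul_id_self
  · have scalar := (stablyEq_trivial_iff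
      ((hF.pull (φ := (Prod.fst : X × X → X)) fun _ _ => rfl).comp
        (hS.pull (φ := (Prod.snd : X × X → X)) fun _ _ => rfl))
      (IsEquivariant.id.smul (a := fun x : X × X => c x.1 x.2)
        fun g x => hc.smul g x.1 x.2)).mp F_S x hx
    exact scalar.trans (mul_one _)

end EffectiveDescent

section Induction

variable {k G V W Z : Type*} [CommRing k] [Group G] {H : Subgroup G}
  [AddCommGroup V] [Module k V] [AddCommGroup W] [Module k W] [AddCommGroup Z] [Module k Z]
  {ρ : Representation k G V} {σ : Representation k G W} {τ : Representation k G Z}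

/-- The family over `G ⧸ H` whose value at a coset is the conjugate of `F` by a representative.
It does not depend on the representatives when `F` is `H`-equivariant, and then corresponds to `F`
under the equivalence between representations of the `G`-set `G ⧸ H` and of `H`. -/
noncomputable def inducedFamily (H : Subgroup G) (ρ : Representation k G V)
    (σ : Representation k G W) (F : V →ₗ[k] W) (q : G ⧸ H) : V →ₗ[k] W :=
  σ q.out ∘ₗ F ∘ₗ ρ q.out⁻¹

theorem inducedFamily_comp (F : V →ₗ[k] W) (E : W →ₗ[k] Z) (q : G ⧸ H) :
    inducedFamily H σ τ E q ∘ₗ inducedFamily H ρ σ F q = inducedFamily H ρ τ (E ∘ₗ F) q := by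
  ext v
  simp [inducedFamily]

theorem inducedFamily_id : inducedFamily H ρ ρ LinearMap.id = fun _ => LinearMap.id := by
  ext q v
  simp [inducedFamily]

theorem inducedFamily_sub (E F : V →ₗ[k] W) :
    inducedFamily H ρ σ (E - F) = inducedFamily H ρ σ E - inducedFamily H ρ σ F := by
  ext q v
  simp [inducedFamily]

namespace IsEquivariant

theorem inducedFamily_mk {F : V →ₗ[k] W}
    (hF : IsEquivariant (ρ.comp H.subtype) (σ.comp H.subtype) (fun _ : PUnit.{1} => F)) (g : G) :
    inducedFamily H ρ σ F (g : G ⧸ H) = σ g ∘ₗ F ∘ₗ ρ g⁻¹ := by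
  obtain ⟨h, hh⟩ := QuotientGroup.mk_out_eq_mul H g
  rw [inducedFamily, hh, mul_inv_rev, map_mul, map_mul]
  nth_rw 2 [← hF.comp_comp_inv h PUnit.unit]
  rfl

theorem inducedFamily {F : V →ₗ[k] W}
    (hF : IsEquivariant (ρ.comp H.subtype) (σ.comp H.subtype) (fun _ : PUnit.{1} => F)) :
    IsEquivariant ρ σ (inducedFamily H ρ σ F) := fun g x => by
  induction x using QuotientGroup.induction_on with | H x => ?_
  change SippCech.inducedFamily H ρ σ F ((g * x : G) : G ⧸ H) ∘ₗ _ = _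
  rw [hF.inducedFamily_mk, hF.inducedFamily_mk, mul_inv_rev, map_mul, map_mul]
  ext v
  simp [← Module.End.mul_apply, ← map_mul]

theorem restrict {F : G ⧸ H → V →ₗ[k] W} (hF : IsEquivariant ρ σ F) :
    IsEquivariant (ρ.comp H.subtype) (σ.comp H.subtype)
      (fun _ : PUnit.{1} => F ((1 : G) : G ⧸ H)) := fun h _ => by
  have fixed : (h : G) • ((1 : G) : G ⧸ H) = ((1 : G) : G ⧸ H) := by
    rw [← MulAction.mem_stabilizer_iff, MulAction.stabilizer_quotient]
    exact h.2
  have := hF h ((1 : G) : G ⧸ H)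
  rwa [fixed] at this

theorem ext_one {E F : G ⧸ H → V →ₗ[k] W} (hE : IsEquivariant ρ σ E) (hF : IsEquivariant ρ σ F)
    (h : E ((1 : G) : G ⧸ H) = F ((1 : G) : G ⧸ H)) : E = F := by
  funext q
  obtain ⟨g, rfl⟩ := MulAction.exists_smul_eq G ((1 : G) : G ⧸ H) q
  rw [← hE.comp_comp_inv g, ← hF.comp_comp_inv g, inv_smul_smul, h]

end IsEquivariant

theorem bijective_out_mul (H : Subgroup G) :
    Function.Bijective fun a : (G ⧸ H) × H => a.1.out * (a.2 : G) :=
  (Subgroup.isComplement_range_left (H := H) Quotient.out_eq').comp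
    ((Equiv.ofInjective Quotient.out Quotient.out_injective).prodCongr (Equiv.refl H)).bijective

variable [Finite G]

theorem isEquivariant_familyTrace {X : Type*} [MulAction G X] (θ : X → V →ₗ[k] W) :
    IsEquivariant ρ σ (familyTrace ρ σ θ) := fun g x => by
  have := Fintype.ofFinite G
  rw [familyTrace_apply, familyTrace_apply, sum_linearMap_comp, linearMap_comp_sum,
    ← Equiv.sum_comp (Equiv.mulLeft g)]
  refine Finset.sum_congr rfl fun h _ => ?_
  rw [Equiv.coe_mulLeft, mul_inv_rev, mul_smul, inv_smul_smul, map_mul, map_mul]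
  ext v
  simp

theorem inducedFamily_familyTrace [DecidableEq (G ⧸ H)] (θ : V →ₗ[k] W) :
    inducedFamily H ρ σ (familyTrace (ρ.comp H.subtype) (σ.comp H.subtype)
      (fun _ : PUnit.{1} => θ) PUnit.unit) =
    familyTrace ρ σ (Pi.single ((1 : G) : G ⧸ H) θ) := by
  classical
  have := Fintype.ofFinite G
  have equivariant : IsEquivariant (ρ.comp H.subtype) (σ.comp H.subtype) (fun _ : PUnit.{1} =>
      familyTrace (ρ.comp H.subtype) (σ.comp H.subtype) (fun _ : PUnit.{1} => θ) PUnit.unit) :=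
    isEquivariant_familyTrace fun _ : PUnit.{1} => θ
  refine equivariant.inducedFamily.ext_one (isEquivariant_familyTrace _) ?_
  have smul_one_eq_iff (g : G) : g⁻¹ • ((1 : G) : G ⧸ H) = ((1 : G) : G ⧸ H) ↔ g ∈ H := by
    rw [← MulAction.mem_stabilizer_iff, MulAction.stabilizer_quotient, inv_mem_iff]
  rw [equivariant.inducedFamily_mk, familyTrace_apply, familyTrace_apply, inv_one, map_one,
    map_one, ← Finset.sum_subset (Finset.subset_univ ({g | g ∈ H} : Finset G)),
    Finset.sum_subtype (p := (· ∈ H)) _ (by simp)]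
  · refine Finset.sum_congr rfl fun h _ => ?_
    rw [(smul_one_eq_iff h).mpr h.2, Pi.single_eq_same]
    rfl
  · intro g _ hg
    rw [Pi.single_eq_of_ne (mt (smul_one_eq_iff g).mp (by simpa using hg)), LinearMap.zero_comp,
      LinearMap.comp_zero]

namespace StablyEq

theorem inducedFamily {E F : V →ₗ[k] W}
    (h : StablyEq (ρ.comp H.subtype) (σ.comp H.subtype) (fun _ : PUnit.{1} => E) (fun _ => F)) :
    StablyEq ρ σ (inducedFamily H ρ σ E) (inducedFamily H ρ σ F) := by
  classical
  obtain ⟨θ, hθ⟩ := h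
  refine ⟨Pi.single ((1 : G) : G ⧸ H) (θ PUnit.unit), ?_⟩
  rw [← inducedFamily_familyTrace, ← inducedFamily_sub]
  exact congrArg (SippCech.inducedFamily H ρ σ) (congrFun hθ PUnit.unit)

theorem restrict {E F : G ⧸ H → V →ₗ[k] W} (h : StablyEq ρ σ E F) :
    StablyEq (ρ.comp H.subtype) (σ.comp H.subtype) (fun _ : PUnit.{1} => E ((1 : G) : G ⧸ H))
      (fun _ => F ((1 : G) : G ⧸ H)) := by
  have := Fintype.ofFinite G
  have := Fintype.ofFinite H
  have := Fintype.ofFinite (G ⧸ H)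
  obtain ⟨θ, hθ⟩ := h
  refine ⟨fun _ => ∑ q : G ⧸ H, σ q.out⁻¹ ∘ₗ θ q ∘ₗ ρ q.out, funext fun _ => ?_⟩
  change _ = (E - F) ((1 : G) : G ⧸ H)
  rw [← hθ, familyTrace_apply, familyTrace_apply, ← Equiv.sum_comp (Equiv.inv G),
    ← (bijective_out_mul H).sum_comp, Fintype.sum_prod_type_right,
    ← Equiv.sum_comp (Equiv.inv H)]
  refine Finset.sum_congr rfl fun h _ => ?_
  rw [sum_linearMap_comp, linearMap_comp_sum]
  refine Finset.sum_congr rfl fun q _ => ?_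
  simp only [Equiv.inv_apply, inv_inv, mul_inv_rev, map_mul]
  ext v
  simp

end StablyEq

end Induction

section StableInduction

variable {k G V W : Type*} [Field k] [Group G] [Finite G] {H : Subgroup G}
  [AddCommGroup V] [Module k V] [AddCommGroup W] [Module k W]
  {ρ : Representation k G V} {σ : Representation k G W}

namespace StablyInverse

theorem inducedFamily {F : V →ₗ[k] W} {S : W →ₗ[k] V}
    (h : StablyInverse (ρ.comp H.subtype) (σ.comp H.subtype) (fun _ : PUnit.{1} => F)
      (fun _ => S)) :
    StablyInverse ρ σ (inducedFamily H ρ σ F) (inducedFamily H σ ρ S) where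
  left := h.left.inducedFamily
  right := h.right.inducedFamily
  right_left := by
    simpa only [inducedFamily_comp, inducedFamily_id] using h.right_left.inducedFamily
  left_right := by
    simpa only [inducedFamily_comp, inducedFamily_id] using h.left_right.inducedFamily

theorem restrict {F : G ⧸ H → V →ₗ[k] W} {S : G ⧸ H → W →ₗ[k] V}
    (h : StablyInverse ρ σ F S) :
    StablyInverse (ρ.comp H.subtype) (σ.comp H.subtype)
      (fun _ : PUnit.{1} => F ((1 : G) : G ⧸ H)) (fun _ => S ((1 : G) : G ⧸ H)) :=
  ⟨h.left.restrict, h.right.restrict, h.right_left.restrict, h.left_right.restrict⟩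

end StablyInverse

end StableInduction

section ConstantRepresentations

variable {k : Type u} [Field k] {G : Type v} [Group G] {X Y : GSet G} {V W : Type u}
  [AddCommGroup V] [Module k V] [AddCommGroup W] [Module k W]
  {ρ : Representation k G V} {σ : Representation k G W}

/-- The constant representation of a `G`-set defined by an arbitrary representation of `G`. It
agrees definitionally with `constRep` and, for the trivial representation on `k`, with
`unitRep`. -/
def repConst (ρ : Representation k G V) (X : GSet G) : GRep k X where
  obj _ := ModuleCat.of k V
  map g := ModuleCat.ofHom (ρ g.1)
  map_id x := by
    change ModuleCat.ofHom (ρ 1) = _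
    rw [map_one]
    rfl
  map_comp f g := by
    change ModuleCat.ofHom (ρ (g.1 * f.1)) = _
    rw [map_mul]
    rfl

/-- The morphism of constant representations defined by an equivariant family. -/
def familyHom (F : X.V → V →ₗ[k] W) (hF : IsEquivariant ρ σ F) :
    repConst ρ X ⟶ repConst σ X where
  app x := ModuleCat.ofHom (F x.back)
  naturality x y g := by
    have h := hF g.1 x.back
    rw [show g.1 • x.back = y.back from g.2] at h
    exact congrArg ModuleCat.ofHom h

/-- The equivariant family defined by a morphism of constant representations. -/
def homFamily (f : repConst ρ X ⟶ repConst σ X) (x : X.V) : V →ₗ[k] W :=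
  (f.app (ActionCategory.objEquiv G X.V x)).hom

theorem isEquivariant_homFamily (f : repConst ρ X ⟶ repConst σ X) :
    IsEquivariant ρ σ (homFamily f) := fun g x => by
  let a : ActionCategory.objEquiv G X.V x ⟶ ActionCategory.objEquiv G X.V (g • x) := ⟨g, rfl⟩
  exact congrArg ModuleCat.Hom.hom (f.naturality a)

theorem homFamily_injective : Function.Injective (homFamily (ρ := ρ) (σ := σ) (X := X)) :=
  fun _ _ h => NatTrans.ext (funext fun x => ModuleCat.hom_ext (congrFun h x.back))

theorem arrow_val_injective (x : ActionCategory G X.V) :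
    Function.Injective fun a : (Σ y : ActionCategory G X.V, y ⟶ x) => a.2.1 := by
  rintro ⟨⟨_, y⟩, g, hg⟩ ⟨⟨_, z⟩, h, hh⟩ (rfl : g = h)
  obtain rfl : y = z := (MulAction.injective (α := G) (β := X.V) g) (hg.trans hh.symm)
  rfl

/-- The arrows with target `x` in the action groupoid are parametrized by the group elements. -/
def arrowEquiv (x : ActionCategory G X.V) : G ≃ Σ y : ActionCategory G X.V, y ⟶ x where
  toFun g := ⟨ActionCategory.objEquiv G X.V (g⁻¹ • x.back), ⟨g, smul_inv_smul g x.back⟩⟩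
  invFun a := a.2.1
  left_inv _ := rfl
  right_inv _ := arrow_val_injective x rfl

theorem inv_arrow_val {x y : ActionCategory G X.V} (f : x ⟶ y) : (inv f).1 = f.1⁻¹ :=
  eq_inv_of_mul_eq_one_left (congrArg Subtype.val (IsIso.hom_inv_id f))

variable [Finite G]

theorem homFamily_traceHom
    (θ : ∀ x : ActionCategory G X.V, (repConst ρ X).obj x ⟶ (repConst σ X).obj x) :
    homFamily (traceHom θ) =
      familyTrace ρ σ fun x => (θ (ActionCategory.objEquiv G X.V x)).hom := by
  have := Fintype.ofFinite G
  funext x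
  refine (congrArg ModuleCat.Hom.hom (traceHom_app_eq_sum θ (arrowEquiv _))).trans ?_
  refine (ModuleCat.hom_sum _ _).trans (Eq.trans ?_ (familyTrace_apply _ x).symm)
  refine Finset.sum_congr rfl fun g _ => ?_
  change σ g ∘ₗ _ ∘ₗ ρ (inv (arrowEquiv (ActionCategory.objEquiv G X.V x) g).2).1 = _
  rw [inv_arrow_val]
  rfl

theorem toStab_map_eq_iff_stablyEq (f g : repConst ρ X ⟶ repConst σ X) :
    (toStab (GRep k X)).map f = (toStab (GRep k X)).map g ↔
      StablyEq ρ σ (homFamily f) (homFamily g) := by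
  rw [toStab_map_eq_iff, stableRel_iff_exists_traceHom_eq fun _ => inferInstance]
  constructor
  · rintro ⟨θ, hθ⟩
    exact ⟨_, (homFamily_traceHom θ).symm.trans (congrArg homFamily hθ)⟩
  · rintro ⟨θ, hθ⟩
    exact ⟨fun x => ModuleCat.ofHom (θ x.back),
      homFamily_injective ((homFamily_traceHom _).trans hθ)⟩

/-- The stable isomorphism of constant representations represented by a pair of stably inverse
families. -/
def stabIso {F : X.V → V →ₗ[k] W} {S : X.V → W →ₗ[k] V} (h : StablyInverse ρ σ F S) :
    (toStab (GRep k X)).obj (repConst ρ X) ≅ (toStab (GRep k X)).obj (repConst σ X) where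
  hom := (toStab (GRep k X)).map (familyHom F h.left)
  inv := (toStab (GRep k X)).map (familyHom S h.right)
  hom_inv_id := by
    rw [← CategoryTheory.Functor.map_comp, ← CategoryTheory.Functor.map_id,
      toStab_map_eq_iff_stablyEq]
    exact h.right_left
  inv_hom_id := by
    rw [← CategoryTheory.Functor.map_comp, ← CategoryTheory.Functor.map_id,
      toStab_map_eq_iff_stablyEq]
    exact h.left_right

theorem exists_eq_stabIso
    (f : (toStab (GRep k X)).obj (repConst ρ X) ≅ (toStab (GRep k X)).obj (repConst σ X)) :
    ∃ (F : X.V → V →ₗ[k] W) (S : X.V → W →ₗ[k] V) (h : StablyInverse ρ σ F S),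
      f = stabIso h := by
  obtain ⟨a, ha⟩ := (toStab (GRep k X)).map_surjective f.hom
  obtain ⟨b, hb⟩ := (toStab (GRep k X)).map_surjective f.inv
  have hom_inv := f.hom_inv_id
  have inv_hom := f.inv_hom_id
  rw [← ha, ← hb, ← CategoryTheory.Functor.map_comp, ← CategoryTheory.Functor.map_id,
    toStab_map_eq_iff_stablyEq] at hom_inv inv_hom
  exact ⟨homFamily a, homFamily b,
    ⟨isEquivariant_homFamily a, isEquivariant_homFamily b, hom_inv, inv_hom⟩, Iso.ext ha.symm⟩

end ConstantRepresentations

section FiniteDimensional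

variable {k : Type u} [Field k] {G : Type v} [Group G] {V W : FDRep k G}

/-- The linear map underlying a morphism of finite dimensional representations. -/
abbrev fdLin (f : V ⟶ W) : V →ₗ[k] W := f.hom.hom.hom

theorem isEquivariant_fdLin (f : V ⟶ W) :
    IsEquivariant V.ρ W.ρ (fun _ : PUnit.{1} => fdLin f) := fun g _ =>
  congrArg (fun t => t.hom.hom) (f.comm g)

/-- The morphism of finite dimensional representations defined by an equivariant linear map. -/
def fdHom (F : V →ₗ[k] W) (hF : IsEquivariant V.ρ W.ρ (fun _ : PUnit.{1} => F)) : V ⟶ W where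
  hom := FGModuleCat.ofHom F
  comm g := FGModuleCat.hom_ext (hF g PUnit.unit)

/-- All arrows of a one-object groupoid, viewed as arrows with a given target. -/
def singleObjArrowEquiv (x : SingleObj G) : G ≃ Σ y : SingleObj G, y ⟶ x where
  toFun g := ⟨SingleObj.star G, g⟩
  invFun a := a.2
  left_inv _ := rfl
  right_inv _ := rfl

theorem fgModuleCat_hom_sum {M N : FGModuleCat k} {ι : Type*} (s : Finset ι) (f : ι → (M ⟶ N)) :
    (∑ i ∈ s, f i).hom.hom = ∑ i ∈ s, (f i).hom.hom :=
  map_sum (AddMonoidHom.mk' (fun f : M ⟶ N => f.hom.hom) fun _ _ => rfl) f s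

variable [Finite G]

theorem traceHom_app_hom_hom
    (θ : ∀ x, ((Action.functorCategoryEquivalence (FGModuleCat k) G).functor.obj V).obj x ⟶
      ((Action.functorCategoryEquivalence (FGModuleCat k) G).functor.obj W).obj x)
    (x : SingleObj G) :
    ((traceHom θ).app x).hom.hom =
      familyTrace V.ρ W.ρ (fun _ : PUnit.{1} => (θ (SingleObj.star G)).hom.hom) PUnit.unit := by
  have := Fintype.ofFinite G
  refine (congrArg (fun t => t.hom.hom) (traceHom_app_eq_sum θ (singleObjArrowEquiv x))).trans ?_
  refine (fgModuleCat_hom_sum _ _).trans (Eq.trans ?_ (familyTrace_apply _ PUnit.unit).symm)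
  refine Finset.sum_congr rfl fun g _ => ?_
  have inv_eq : (inv (singleObjArrowEquiv x g).2 : G) = g⁻¹ :=
    eq_inv_of_mul_eq_one_left (a := (inv (singleObjArrowEquiv x g).2 : G))
      (IsIso.hom_inv_id (singleObjArrowEquiv x g).2)
  change W.ρ g ∘ₗ _ ∘ₗ V.ρ (inv (singleObjArrowEquiv x g).2 : G) = _
  rw [inv_eq]
  rfl

theorem toStab_fdRep_map_eq_iff_stablyEq (f g : V ⟶ W) :
    (toStab (FDRep k G)).map f = (toStab (FDRep k G)).map g ↔
      StablyEq V.ρ W.ρ (fun _ : PUnit.{1} => fdLin f) (fun _ => fdLin g) := by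
  have := HasFiniteBiproducts.of_hasFiniteProducts (C := FGModuleCat k)
  have : HasBinaryBiproducts (FDRep k G) := HasBinaryBiproducts.of_hasBinaryProducts
  rw [toStab_map_eq_iff,
    ← stableRel_equivalence_iff (Action.functorCategoryEquivalence (FGModuleCat k) G),
    stableRel_iff_exists_traceHom_eq (projective_fgModuleCat k)]
  constructor
  · rintro ⟨θ, hθ⟩
    refine ⟨_, funext fun _ => (traceHom_app_hom_hom θ (SingleObj.star G)).symm.trans ?_⟩
    exact congrArg (fun t => (t.app (SingleObj.star G)).hom.hom) hθ
  · rintro ⟨θ, hθ⟩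
    refine ⟨fun _ => FGModuleCat.ofHom (θ PUnit.unit), NatTrans.ext (funext fun x =>
      FGModuleCat.hom_ext ((traceHom_app_hom_hom _ x).trans ?_))⟩
    exact congrFun hθ PUnit.unit

/-- The stable isomorphism of `kG`-modules represented by a pair of stably inverse maps. -/
def fdStabIso {F : PUnit.{1} → V →ₗ[k] W} {S : PUnit.{1} → W →ₗ[k] V}
    (h : StablyInverse V.ρ W.ρ F S) :
    (toStab (FDRep k G)).obj V ≅ (toStab (FDRep k G)).obj W where
  hom := (toStab (FDRep k G)).map (fdHom (F PUnit.unit) h.left)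
  inv := (toStab (FDRep k G)).map (fdHom (S PUnit.unit) h.right)
  hom_inv_id := by
    rw [← CategoryTheory.Functor.map_comp, ← CategoryTheory.Functor.map_id,
      toStab_fdRep_map_eq_iff_stablyEq]
    exact h.right_left
  inv_hom_id := by
    rw [← CategoryTheory.Functor.map_comp, ← CategoryTheory.Functor.map_id,
      toStab_fdRep_map_eq_iff_stablyEq]
    exact h.left_right

theorem exists_stablyInverse_of_fd_iso
    (f : (toStab (FDRep k G)).obj V ≅ (toStab (FDRep k G)).obj W) :
    ∃ (F : V →ₗ[k] W) (S : W →ₗ[k] V),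
      StablyInverse V.ρ W.ρ (fun _ : PUnit.{1} => F) (fun _ => S) := by
  obtain ⟨a, ha⟩ := (toStab (FDRep k G)).map_surjective f.hom
  obtain ⟨b, hb⟩ := (toStab (FDRep k G)).map_surjective f.inv
  have hom_inv := f.hom_inv_id
  have inv_hom := f.inv_hom_id
  rw [← ha, ← hb, ← CategoryTheory.Functor.map_comp, ← CategoryTheory.Functor.map_id,
    toStab_fdRep_map_eq_iff_stablyEq] at hom_inv inv_hom
  exact ⟨fdLin a, fdLin b, isEquivariant_fdLin a, isEquivariant_fdLin b, hom_inv, inv_hom⟩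

end FiniteDimensional

section Scalars

variable {k : Type u} [Field k] {G : Type v} [Group G] {X Y : GSet G}

theorem cast_card_stabilizer_hom_eq_zero (φ : Y ⟶ X) {y : Y.V}
    (hy : (Nat.card (MulAction.stabilizer G y) : k) = 0) :
    (Nat.card (MulAction.stabilizer G (φ.hom y)) : k) = 0 := by
  obtain ⟨n, hn⟩ := Subgroup.card_dvd_of_le (gset_stabilizer_le φ y)
  rw [hn, Nat.cast_mul, hy, zero_mul]

variable [Finite G] {F S E T : X.V → k →ₗ[k] k}

/-- The section of `Gm` represented by a pair of stably inverse families of scalars. -/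
def gmOfFamily (h : StablyInverse (Representation.trivial k G k) (Representation.trivial k G k)
    F S) : (Gm G k).obj (op X) :=
  gmOfIso (stabIso h)

theorem exists_eq_gmOfFamily (z : (Gm G k).obj (op X)) :
    ∃ (F S : X.V → k →ₗ[k] k)
      (h : StablyInverse (Representation.trivial k G k) (Representation.trivial k G k) F S),
      z = gmOfFamily h := by
  obtain ⟨F, S, h, hz⟩ := exists_eq_stabIso (ρ := Representation.trivial k G k)
    (σ := Representation.trivial k G k) (Additive.toMul (α := Aut (stUnit k X)) z)
  exact ⟨F, S, h, congrArg gmOfIso hz⟩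

theorem gmOfFamily_eq_iff
    {h : StablyInverse (Representation.trivial k G k) (Representation.trivial k G k) F S}
    {h' : StablyInverse (Representation.trivial k G k) (Representation.trivial k G k) E T} :
    gmOfFamily h = gmOfFamily h' ↔
      ∀ x, (Nat.card (MulAction.stabilizer G x) : k) = 0 → F x 1 = E x 1 := by
  refine Iff.trans ⟨fun H => congrArg (fun z => (Additive.toMul (α := Aut (stUnit k X)) z).hom) H,
    fun H => congrArg gmOfIso (Iso.ext H)⟩ ?_
  exact (toStab_map_eq_iff_stablyEq (familyHom F h.left) (familyHom E h'.left)).trans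
    (stablyEq_trivial_iff h.left h'.left)

theorem gmOfFamily_comp
    (h : StablyInverse (Representation.trivial k G k) (Representation.trivial k G k) F S)
    (h' : StablyInverse (Representation.trivial k G k) (Representation.trivial k G k) E T) :
    gmOfFamily (h.comp h') = gmOfFamily h' + gmOfFamily h :=
  (congrArg gmOfIso (Iso.ext ((toStab (GRep k X)).map_comp (familyHom F h.left)
    (familyHom E h'.left)))).trans (gmOfIso_trans _ _)

theorem Gm_map_gmOfFamily (φ : Y ⟶ X)
    (h : StablyInverse (Representation.trivial k G k) (Representation.trivial k G k) F S) :
    (Gm G k).map φ.op (gmOfFamily h) = gmOfFamily (h.pull (gset_hom_smul φ)) :=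
  congrArg gmOfIso (Iso.ext rfl)

/-- The scalar by which a section of `Gm` acts at a point. It depends on a choice, except at the
points whose stabilizer has order divisible by the characteristic. -/
noncomputable def gmScalar (z : (Gm G k).obj (op X)) (x : X.V) : k :=
  (exists_eq_gmOfFamily z).choose x 1

theorem gmScalar_gmOfFamily
    (h : StablyInverse (Representation.trivial k G k) (Representation.trivial k G k) F S) {x : X.V}
    (hx : (Nat.card (MulAction.stabilizer G x) : k) = 0) : gmScalar (gmOfFamily h) x = F x 1 :=
  (gmOfFamily_eq_iff.mp (exists_eq_gmOfFamily (gmOfFamily h)).choose_spec.choose_spec.choose_spec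
    x hx).symm

theorem gmScalar_gmOfIso {f : stUnit k X ≅ stUnit k X} {m : unitRep k X ⟶ unitRep k X}
    (hm : (toStab (GRep k X)).map m = f.hom) {x : X.V}
    (hx : (Nat.card (MulAction.stabilizer G x) : k) = 0) :
    gmScalar (gmOfIso f) x = (m.app (ActionCategory.objEquiv G X.V x)).hom (1 : k) := by
  obtain ⟨F, S, h, hf⟩ := exists_eq_gmOfFamily (gmOfIso f)
  rw [hf, gmScalar_gmOfFamily h hx]
  have map_eq : (toStab (GRep k X)).map (familyHom F h.left) = (toStab (GRep k X)).map m :=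
    (congrArg (fun z => (Additive.toMul (α := Aut (stUnit k X)) z).hom) hf).symm.trans hm.symm
  exact (stablyEq_trivial_iff h.left (isEquivariant_homFamily (ρ := Representation.trivial k G k)
    (σ := Representation.trivial k G k) m)).mp
    ((toStab_map_eq_iff_stablyEq _ _).mp map_eq) x hx

theorem gmScalar_smul (z : (Gm G k).obj (op X)) (g : G) (x : X.V) :
    gmScalar z (g • x) = gmScalar z x :=
  (exists_eq_gmOfFamily z).choose_spec.choose_spec.choose.left.apply_smul_one g x

theorem gm_ext {z w : (Gm G k).obj (op X)}
    (h : ∀ x, (Nat.card (MulAction.stabilizer G x) : k) = 0 → gmScalar z x = gmScalar w x) :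
    z = w := by
  obtain ⟨F, S, hF, rfl⟩ := exists_eq_gmOfFamily z
  obtain ⟨E, T, hE, rfl⟩ := exists_eq_gmOfFamily w
  refine gmOfFamily_eq_iff.mpr fun x hx => ?_
  rw [← gmScalar_gmOfFamily hF hx, ← gmScalar_gmOfFamily hE hx, h x hx]

theorem gmScalar_map (φ : Y ⟶ X) (z : (Gm G k).obj (op X)) {y : Y.V}
    (hy : (Nat.card (MulAction.stabilizer G y) : k) = 0) :
    gmScalar ((Gm G k).map φ.op z) y = gmScalar z (φ.hom y) := by
  obtain ⟨F, S, h, rfl⟩ := exists_eq_gmOfFamily z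
  rw [Gm_map_gmOfFamily, gmScalar_gmOfFamily _ hy,
    gmScalar_gmOfFamily _ (cast_card_stabilizer_hom_eq_zero φ hy)]

theorem exists_gmScalar_eq {c : X.V → kˣ} (hc : ∀ (g : G) x, c (g • x) = c x) :
    ∃ z : (Gm G k).obj (op X),
      ∀ x, (Nat.card (MulAction.stabilizer G x) : k) = 0 → gmScalar z x = c x := by
  have h : StablyInverse (Representation.trivial k G k) (Representation.trivial k G k)
      (fun x => (c x : k) • LinearMap.id) (fun x => (↑(c x)⁻¹ : k) • LinearMap.id) :=
    { left := IsEquivariant.id.smul (a := fun x => (c x : k)) fun g x => by rw [hc]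
      right := IsEquivariant.id.smul (a := fun x => (↑(c x)⁻¹ : k)) fun g x => by rw [hc]
      right_left := by
        simp only [LinearMap.comp_smul, smul_smul, Units.mul_inv, one_smul, LinearMap.comp_id]
        exact .refl _
      left_right := by
        simp only [LinearMap.comp_smul, smul_smul, Units.inv_mul, one_smul, LinearMap.comp_id]
        exact .refl _ }
  exact ⟨gmOfFamily h, fun x hx => (gmScalar_gmOfFamily h hx).trans (mul_one _)⟩

variable {x : X.V} (hx : (Nat.card (MulAction.stabilizer G x) : k) = 0)
include hx

theorem gmScalar_add (z w : (Gm G k).obj (op X)) :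
    gmScalar (z + w) x = gmScalar z x * gmScalar w x := by
  obtain ⟨F, S, hF, rfl⟩ := exists_eq_gmOfFamily z
  obtain ⟨E, T, hE, rfl⟩ := exists_eq_gmOfFamily w
  rw [← gmOfFamily_comp, gmScalar_gmOfFamily _ hx, gmScalar_gmOfFamily _ hx,
    gmScalar_gmOfFamily _ hx, LinearMap.comp_apply, mul_comm, ← smul_eq_mul, ← map_smul,
    smul_eq_mul, mul_one]

theorem gmScalar_ne_zero (z : (Gm G k).obj (op X)) : gmScalar z x ≠ 0 := by
  obtain ⟨F, S, hF, rfl⟩ := exists_eq_gmOfFamily z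
  refine right_ne_zero_of_mul_eq_one (a := S x 1) ?_
  rw [gmScalar_gmOfFamily _ hx, ← smul_eq_mul, ← map_smul, smul_eq_mul, mul_one]
  exact hF.apply_apply_one hx

theorem gmScalar_zero : gmScalar (0 : (Gm G k).obj (op X)) x = 1 :=
  mul_left_cancel₀ (gmScalar_ne_zero hx 0) (by rw [← gmScalar_add hx, add_zero, mul_one])

end Scalars

section ConstantSheaf

variable {G : Type v} [Group G] {p : ℕ} {X : GSet G}

theorem exists_eq_pOrbit (o : POrbits p X) :
    ∃ (x : X.V) (hx : p ∣ Nat.card (MulAction.stabilizer G x)), o = pOrbit x hx := by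
  obtain ⟨o, x, rfl, hx⟩ := o
  exact ⟨x, hx, rfl⟩

theorem pOrbit_eq_pOrbit_iff {x y : X.V} {hx : p ∣ Nat.card (MulAction.stabilizer G x)}
    {hy : p ∣ Nat.card (MulAction.stabilizer G y)} :
    pOrbit x hx = pOrbit y hy ↔ x ∈ MulAction.orbit G y :=
  Subtype.ext_iff.trans Quotient.eq

variable {k : Type u} [Field k] [CharP k p]

theorem cast_card_stabilizer_eq_zero {x : X.V} (hx : p ∣ Nat.card (MulAction.stabilizer G x)) :
    (Nat.card (MulAction.stabilizer G x) : k) = 0 :=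
  (CharP.cast_eq_zero_iff k p _).mpr hx

variable [Finite G]

/-- The function on orbits given by the scalars of a section of `Gm`. -/
noncomputable def orbitScalar (z : (Gm G k).obj (op X)) (o : POrbits p X) : Additive kˣ :=
  Additive.ofMul (Units.mk0 (gmScalar z (exists_eq_pOrbit o).choose)
    (gmScalar_ne_zero (cast_card_stabilizer_eq_zero (exists_eq_pOrbit o).choose_spec.choose) z))

theorem orbitScalar_pOrbit (z : (Gm G k).obj (op X)) {x : X.V}
    (hx : p ∣ Nat.card (MulAction.stabilizer G x)) :
    ((orbitScalar z (pOrbit x hx)).toMul : k) = gmScalar z x := by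
  obtain ⟨g, hg⟩ := pOrbit_eq_pOrbit_iff.mp (exists_eq_pOrbit (pOrbit x hx)).choose_spec.choose_spec
  exact (gmScalar_smul z g _).symm.trans (congrArg (gmScalar z) hg)

theorem orbitScalar_eq_iff {z : (Gm G k).obj (op X)} {c : POrbits p X → Additive kˣ} :
    orbitScalar z = c ↔ ∀ (x : X.V) (hx : p ∣ Nat.card (MulAction.stabilizer G x)),
      gmScalar z x = (c (pOrbit x hx)).toMul := by
  refine ⟨fun h x hx => by rw [← h, orbitScalar_pOrbit], fun h => funext fun o => ?_⟩
  obtain ⟨x, hx, rfl⟩ := exists_eq_pOrbit o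
  exact congrArg Additive.ofMul (Units.ext ((orbitScalar_pOrbit z hx).trans (h x hx)))

theorem orbitScalar_bijective :
    Function.Bijective (orbitScalar : (Gm G k).obj (op X) → POrbits p X → Additive kˣ) := by
  classical
  refine ⟨fun z w h => gm_ext fun x hx => ?_, fun c => ?_⟩
  · have hx := (CharP.cast_eq_zero_iff k p _).mp hx
    rw [← orbitScalar_pOrbit z hx, h, orbitScalar_pOrbit]
  · let a (x : X.V) : kˣ :=
      if hx : p ∣ Nat.card (MulAction.stabilizer G x) then (c (pOrbit x hx)).toMul else 1
    have ha (g : G) (x : X.V) : a (g • x) = a x := by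
      refine dite_congr (congrArg (p ∣ ·) (card_stabilizer_smul g x)) (fun hx => ?_) fun _ => rfl
      exact congrArg (fun o => (c o).toMul) (pOrbit_eq_pOrbit_iff.mpr ⟨g, rfl⟩)
    obtain ⟨z, hz⟩ := exists_gmScalar_eq ha
    refine ⟨z, orbitScalar_eq_iff.mpr fun x hx => ?_⟩
    rw [hz x (cast_card_stabilizer_eq_zero hx)]
    exact congrArg Units.val (dif_pos hx)

variable (X) in
/-- Sections of `Gm` as functions on orbits. -/
noncomputable def gmEquiv : (Gm G k).obj (op X) ≃+ (POrbits p X → Additive kˣ) :=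
  AddEquiv.mk' (Equiv.ofBijective orbitScalar orbitScalar_bijective) fun z w =>
    orbitScalar_eq_iff.mpr fun x hx => by
      rw [gmScalar_add (cast_card_stabilizer_eq_zero hx), ← orbitScalar_pOrbit z hx,
        ← orbitScalar_pOrbit w hx]
      rfl

/-- The identification of the constant sipp sheaf of units with `Gm`. -/
noncomputable def constSheafIso : constSheaf G p (Additive kˣ) ≅ Gm G k :=
  (NatIso.ofComponents (fun X => (gmEquiv (p := p) X.unop).toAddCommGrpIso) fun {X Y} φ => by
    ext z
    refine orbitScalar_eq_iff.mpr fun y hy => ?_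
    have hφ := hy.trans (Subgroup.card_dvd_of_le (gset_stabilizer_le φ.unop y))
    exact (gmScalar_map φ.unop z (cast_card_stabilizer_eq_zero hy)).trans
      (orbitScalar_pOrbit z hφ).symm).symm

theorem exists_constSheaf_iso (p : ℕ) [CharP k p] :
    ∃ θ : constSheaf G p (Additive kˣ) ≅ Gm G k,
      ∀ (X : GSet G) (c : POrbits p X → Additive kˣ) (a : Aut (unitRep k X)),
        (∀ (x : X.V) (hx : p ∣ Nat.card (MulAction.stabilizer G x)) (t : k),
          (a.hom.app ((ActionCategory.objEquiv G X.V) x)).hom t =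
            ((c (pOrbit x hx)).toMul : k) * t) →
        (θ.hom.app (op X)).hom c = Additive.ofMul ((toStab _).mapIso a) := by
  refine ⟨constSheafIso, fun X c a ha => ?_⟩
  refine (gmEquiv X).symm_apply_eq.mpr (orbitScalar_eq_iff.mpr fun x hx => ?_).symm
  refine (gmScalar_gmOfIso (m := a.hom) rfl (cast_card_stabilizer_eq_zero hx)).trans ?_
  exact (ha x hx (1 : k)).trans (mul_one ((c (pOrbit x hx)).toMul : k))

end ConstantSheaf

theorem stabilizer_prod_mk {G M N : Type*} [Group G] [MulAction G M] [MulAction G N] (x : M)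
    (y : N) :
    MulAction.stabilizer G (x, y) = MulAction.stabilizer G x ⊓ MulAction.stabilizer G y := by
  ext g
  exact Prod.ext_iff

section FibrePowers

variable {G : Type v} [Group G] {U X : GSet G} (α : U ⟶ X)

theorem smul_fibPow_eq_iff {n : ℕ} (g : G) (w : FibPow α n) :
    g • w = w ↔ ∀ i, g • w.1 i = w.1 i := by
  rw [Subtype.ext_iff, funext_iff]
  rfl

theorem stabilizer_fibPow_two (w : FibPow α 2) :
    MulAction.stabilizer G w = MulAction.stabilizer G (w.1 0, w.1 1) := by
  ext g
  rw [MulAction.mem_stabilizer_iff, MulAction.mem_stabilizer_iff, smul_fibPow_eq_iff,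
    Fin.forall_fin_two, Prod.ext_iff]
  rfl

theorem stabilizer_fibPow_three (w : FibPow α 3) :
    MulAction.stabilizer G w = MulAction.stabilizer G (w.1 0, w.1 1, w.1 2) := by
  ext g
  rw [MulAction.mem_stabilizer_iff, MulAction.mem_stabilizer_iff, smul_fibPow_eq_iff,
    Prod.ext_iff, Prod.ext_iff, Fin.forall_fin_succ, Fin.forall_fin_two]
  rfl

end FibrePowers

section GluingScalars

variable {k : Type u} [Field k] {G : Type v} [Group G] [Finite G] {U X : GSet G} (α : U ⟶ X)
  {V V' : FDRep k G}

theorem gluing_stabIso {F : U.V → V →ₗ[k] k} {S : U.V → k →ₗ[k] V}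
    (h : StablyInverse V.ρ (Representation.trivial k G k) F S) :
    gluing α (stabIso h) = gmOfFamily ((h.pull (gset_hom_smul (fibProj α 1))).symm.comp
      (h.pull (gset_hom_smul (fibProj α 0)))) := by
  refine congrArg gmOfIso (Iso.ext ?_)
  exact ((toStab (GRep k (fibPow α 2))).map_comp
    (familyHom _ (h.pull (gset_hom_smul (fibProj α 1))).right)
    (familyHom _ (h.pull (gset_hom_smul (fibProj α 0))).left)).symm

theorem gmScalar_gluing {F : U.V → V →ₗ[k] k} {S : U.V → k →ₗ[k] V}
    (h : StablyInverse V.ρ (Representation.trivial k G k) F S) {w : FibPow α 2}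
    (hw : (Nat.card (MulAction.stabilizer G w) : k) = 0) :
    gmScalar (gluing α (stabIso h)) w = F (w.1 0) (S (w.1 1) 1) := by
  rw [gluing_stabIso]
  exact gmScalar_gmOfFamily _ hw

theorem stablyInverse_lid {Y : Type*} [MulAction G Y] :
    StablyInverse ((Representation.trivial k G k).tprod (Representation.trivial k G k))
      (Representation.trivial k G k)
      (fun _ : Y => (TensorProduct.lid k k).toLinearMap)
      (fun _ : Y => (TensorProduct.lid k k).symm.toLinearMap) where
  left g x := by
    ext
    simp
  right g x := by
    ext
    simp
  right_left := by
    simp only [LinearEquiv.symm_comp]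
    exact .refl _
  left_right := by
    simp only [LinearEquiv.comp_symm]
    exact .refl _

theorem exists_gluing_tensor (f : stConst k V U ≅ stUnit k U) (f' : stConst k V' U ≅ stUnit k U) :
    ∃ f'' : stConst k (V ⊗ V') U ≅ stUnit k U,
      gluing α f'' = gluing α f + gluing α f' := by
  obtain ⟨F, S, h, rfl⟩ := exists_eq_stabIso (ρ := V.ρ) (σ := Representation.trivial k G k) f
  obtain ⟨F', S', h', rfl⟩ := exists_eq_stabIso (ρ := V'.ρ) (σ := Representation.trivial k G k) f'
  have htensor : StablyInverse (FDRep.ρ (V ⊗ V')) (Representation.trivial k G k) _ _ :=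
    (h.tensor h').comp stablyInverse_lid
  refine ⟨stabIso htensor, gm_ext fun w hw => ?_⟩
  rw [gmScalar_add hw]
  refine (gmScalar_gluing α htensor hw).trans ?_
  exact congrArg₂ (· * ·) (gmScalar_gluing α h hw).symm (gmScalar_gluing α h' hw).symm

theorem exists_gluing_eq_zero {f : stConst k V U ≅ stUnit k U}
    (hf : gluing α f ∈ (cechD (Gm G k) α 0).range) :
    ∃ f' : stConst k V U ≅ stUnit k U, gluing α f' = 0 := by
  obtain ⟨a, ha⟩ := (mem_range_cechD_zero_iff _ α).mp hf
  refine ⟨f ≪≫ Additive.toMul (α := Aut (stUnit k U)) a, ?_⟩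
  refine (transition_trans (fibProj α 0) (fibProj α 1) f _).trans ?_
  change (Gm G k).map (fibProj α 0).op a + gluing α f - (Gm G k).map (fibProj α 1).op a = 0
  rw [← ha]
  abel

theorem gmScalar_mul_gmScalar {z : (Gm G k).obj (op (fibPow α 2))}
    (hz : cechD (Gm G k) α 1 z = 0) {w : FibPow α 3}
    (hw : (Nat.card (MulAction.stabilizer G w) : k) = 0) :
    gmScalar z ((fibFace α 2).hom w) * gmScalar z ((fibFace α 0).hom w) =
      gmScalar z ((fibFace α 1).hom w) := by
  have hfaces : (Gm G k).map (fibFace α 2).op z + (Gm G k).map (fibFace α 0).op z =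
      (Gm G k).map (fibFace α 1).op z := by
    rw [cechD_one_apply, sub_add_eq_add_sub, sub_eq_zero] at hz
    exact (add_comm _ _).trans hz
  have hmap (i : Fin 3) :
      gmScalar ((Gm G k).map (fibFace α i).op z) w = gmScalar z ((fibFace α i).hom w) :=
    gmScalar_map (Y := fibPow α 3) (fibFace α i) z hw
  rw [← hmap, ← hmap, ← hmap, ← hfaces]
  exact (gmScalar_add (X := fibPow α 3) hw _ _).symm

variable {α} (hα : ∀ x y : U.V, α.hom x = α.hom y)
include hα

theorem nonempty_iso_of_gluing_mem (hU : (Nat.card U.V : k) ≠ 0)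
    {f : stConst k V U ≅ stUnit k U} (hf : gluing α f ∈ (cechD (Gm G k) α 0).range) :
    Nonempty ((toStab (FDRep k G)).obj V ≅ (toStab (FDRep k G)).obj (𝟙_ (FDRep k G))) := by
  obtain ⟨f', hf'⟩ := exists_gluing_eq_zero α hf
  obtain ⟨F, S, h, rfl⟩ := exists_eq_stabIso (ρ := V.ρ) (σ := Representation.trivial k G k) f'
  have transition_eq_one (x : U.V × U.V) (hx : (Nat.card (MulAction.stabilizer G x) : k) = 0) :
      F x.1 (S x.2 1) = 1 := by
    obtain ⟨x, y⟩ := x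
    let w : FibPow α 2 := ⟨![x, y], fun _ _ => hα _ _⟩
    have hw : (Nat.card (MulAction.stabilizer G w) : k) = 0 := by rwa [stabilizer_fibPow_two]
    have hFS := gmScalar_gluing α h hw
    rw [hf', gmScalar_zero (X := fibPow α 2) hw] at hFS
    exact hFS.symm
  exact ⟨fdStabIso (W := 𝟙_ (FDRep k G))
    (h.average hU (h.stablyEq_of_apply_apply_one transition_eq_one))⟩

theorem isStableCocycle_gmScalar {z : (Gm G k).obj (op (fibPow α 2))}
    (hz : cechD (Gm G k) α 1 z = 0) :
    IsStableCocycle k G fun x y : U.V =>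
      gmScalar z (⟨![x, y], fun _ _ => hα _ _⟩ : FibPow α 2) := by
  let pair (x y : U.V) : FibPow α 2 := ⟨![x, y], fun _ _ => hα _ _⟩
  have pair_mul (x y t : U.V) (h : (Nat.card (MulAction.stabilizer G (x, y, t)) : k) = 0) :
      gmScalar z (pair x y) * gmScalar z (pair y t) = gmScalar z (pair x t) := by
    let w : FibPow α 3 := ⟨![x, y, t], fun _ _ => hα _ _⟩
    have hw : (Nat.card (MulAction.stabilizer G w) : k) = 0 := by rwa [stabilizer_fibPow_three]
    have hxy : pair x y = (fibFace α 2).hom w :=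
      Subtype.ext (funext fun i => by fin_cases i <;> rfl)
    have hyt : pair y t = (fibFace α 0).hom w :=
      Subtype.ext (funext fun i => by fin_cases i <;> rfl)
    have hxt : pair x t = (fibFace α 1).hom w :=
      Subtype.ext (funext fun i => by fin_cases i <;> rfl)
    rw [hxy, hyt, hxt]
    exact gmScalar_mul_gmScalar α hz hw
  refine ⟨fun g x y => ?_, pair_mul, fun x hx => ?_⟩
  · refine Eq.trans (congrArg (gmScalar z) ?_) (gmScalar_smul z g (pair x y))
    exact Subtype.ext (funext fun i => by fin_cases i <;> rfl)
  · have hdiag : MulAction.stabilizer G (pair x x) = MulAction.stabilizer G x :=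
      (stabilizer_fibPow_two α _).trans ((stabilizer_prod_mk x x).trans (inf_idem _))
    have hpair : (Nat.card (MulAction.stabilizer G (pair x x)) : k) = 0 := by rwa [hdiag]
    have htriple : (Nat.card (MulAction.stabilizer G (x, x, x)) : k) = 0 := by
      rwa [stabilizer_prod_mk, stabilizer_prod_mk, inf_idem, inf_idem]
    exact mul_left_cancel₀ (gmScalar_ne_zero (X := fibPow α 2) hpair z)
      ((pair_mul x x x htriple).trans (mul_one _).symm)

theorem exists_gluing_eq (hU : (Nat.card U.V : k) ≠ 0)
    {z : (Gm G k).obj (op (fibPow α 2))} (hz : cechD (Gm G k) α 1 z = 0) :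
    ∃ (V : FDRep k G) (f : stConst k V U ≅ stUnit k U), gluing α f = z := by
  obtain ⟨d, ρ, F, S, h, hFS⟩ :=
    exists_stablyInverse_of_cocycle hU (isStableCocycle_gmScalar hα hz)
  refine ⟨FDRep.of ρ, stabIso (X := U) h, gm_ext fun w hw => ?_⟩
  refine (gmScalar_gluing α (V := FDRep.of ρ) h hw).trans ?_
  refine (hFS (w.1 0, w.1 1) ?_).trans (congrArg (gmScalar z) ?_)
  · rwa [← stabilizer_fibPow_two α w]
  · exact Subtype.ext (funext fun i => by fin_cases i <;> rfl)

end GluingScalars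

section Restriction

variable {k : Type u} [Field k] {G : Type v} [Group G] [Finite G] (H : Subgroup G)

theorem nonempty_stConst_iso_iff (V : FDRep k G) :
    Nonempty (stConst k V (gset G (G ⧸ H)) ≅ stUnit k (gset G (G ⧸ H))) ↔
      Nonempty ((toStab (FDRep k H)).obj ((resFD k H).obj V) ≅
        (toStab (FDRep k H)).obj (𝟙_ (FDRep k H))) := by
  constructor
  · rintro ⟨f⟩
    obtain ⟨F, S, h, rfl⟩ := exists_eq_stabIso (ρ := V.ρ) (σ := Representation.trivial k G k) f
    exact ⟨fdStabIso (V := (resFD k H).obj V) (W := 𝟙_ (FDRep k H))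
      (StablyInverse.restrict (F := F) (S := S) h)⟩
  · rintro ⟨f⟩
    obtain ⟨F, S, h⟩ := exists_stablyInverse_of_fd_iso f
    have hinduced : StablyInverse (ρ := V.ρ) (σ := Representation.trivial k G k) _ _ :=
      StablyInverse.inducedFamily (H := H) (ρ := V.ρ) (σ := Representation.trivial k G k) h
    exact ⟨stabIso (X := gset G (G ⧸ H)) hinduced⟩

theorem toSkeleton_res_eq_one_iff (V : FDRep k G) :
    Skeleton.monoidHom (stabMap (resFD k H)) (toSkeleton ((toStab (FDRep k G)).obj V)) = 1 ↔
      Nonempty (stConst k V (gset G (G ⧸ H)) ≅ stUnit k (gset G (G ⧸ H))) := by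
  rw [nonempty_stConst_iso_iff]
  change (stabMap (resFD k H)).mapSkeleton.obj (toSkeleton ((toStab (FDRep k G)).obj V)) =
    toSkeleton (𝟙_ (StMod k H)) ↔ _
  rw [Functor.mapSkeleton_obj_toSkeleton]
  exact toSkeleton_eq_toSkeleton_iff

end Restriction

section SippCover

variable {G : Type v} [Group G] (H : Subgroup G)

theorem cast_card_quotient_ne_zero {p : ℕ} [Fact p.Prime] (k : Type u) [Field k] [CharP k p]
    (hH : H.index.Coprime p) : (Nat.card (G ⧸ H) : k) ≠ 0 := by
  rw [Ne, CharP.cast_eq_zero_iff k p, ← Subgroup.index]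
  exact (Nat.Prime.coprime_iff_not_dvd Fact.out).mp hH.symm

variable [Finite G]

theorem orbitCover_hom_eq (x y : G ⧸ H) : (orbitCover H).hom x = (orbitCover H).hom y :=
  (QuotientGroup.subsingleton_quotient_top (G := G)).elim _ _

theorem isSippCover_orbitCover {p : ℕ} (hH : H.index.Coprime p) :
    IsSippCover p (orbitCover H) := fun x => by
  refine ⟨((1 : G) : G ⧸ H), (QuotientGroup.subsingleton_quotient_top (G := G)).elim _ _, ?_⟩
  have stabilizer_eq_top : MulAction.stabilizer G (show G ⧸ (⊤ : Subgroup G) from x) = ⊤ :=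
    eq_top_iff.mpr fun g _ => (QuotientGroup.subsingleton_quotient_top (G := G)).elim _ _
  have relIndex_eq : (MulAction.stabilizer G ((1 : G) : G ⧸ H)).relIndex
      (MulAction.stabilizer G (show G ⧸ (⊤ : Subgroup G) from x)) = H.index := by
    rw [MulAction.stabilizer_quotient, stabilizer_eq_top, Subgroup.relIndex_top_right]
  exact relIndex_eq ▸ hH

end SippCover

section Comparison

variable {G : Type v} [Group G] {P : (GSet G)ᵒᵖ ⥤ AddCommGrpCat.{w}} {U X : GSet G} {α : U ⟶ X}

theorem cechH_mk_eq_iff {z z' : P.obj (op (fibPow α 2))} (hz : cechD P α 1 z = 0)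
    (hz' : cechD P α 1 z' = 0) :
    CechH.mk z hz = CechH.mk z' hz' ↔ z - z' ∈ (cechD P α 0).range := by
  refine (QuotientAddGroup.eq (s := (cechB P α 1).addSubgroupOf (cechD P α 1).ker)).trans ?_
  rw [AddSubgroup.mem_addSubgroupOf, ← neg_mem_iff, cechB]
  refine iff_of_eq (congrArg (· ∈ (cechD P α 0).range) ?_)
  change -(-z + z') = z - z'
  abel

theorem cechH_mk_add {z z' : P.obj (op (fibPow α 2))} (hz : cechD P α 1 z = 0)
    (hz' : cechD P α 1 z' = 0) :
    CechH.mk (z + z') (by rw [map_add, hz, hz', add_zero]) = CechH.mk z hz + CechH.mk z' hz' :=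
  rfl

end Comparison

section EndotrivialKer

variable {k : Type u} [Field k] {G : Type v} [Group G]

theorem exists_toSkeleton_eq (t : Skeleton (StMod k G)) :
    ∃ V : FDRep k G, t = toSkeleton ((toStab (FDRep k G)).obj V) :=
  ⟨((fromSkeleton _).obj t).as, (toSkeleton_fromSkeleton_obj t).symm⟩

theorem toSkeleton_tensor (V W : FDRep k G) :
    toSkeleton ((toStab (FDRep k G)).obj (V ⊗ W)) =
      toSkeleton ((toStab (FDRep k G)).obj V) * toSkeleton ((toStab (FDRep k G)).obj W) :=
  Skeleton.toSkeleton_tensorObj ((toStab (FDRep k G)).obj V) ((toStab (FDRep k G)).obj W)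

variable [Finite G] {H : Subgroup G}

theorem mem_endotrivialKer_iff {t : EndotrivialGroup k G} {V : FDRep k G}
    (h : t.val = toSkeleton ((toStab (FDRep k G)).obj V)) :
    t ∈ EndotrivialKer k H ↔
      Nonempty (stConst k V (gset G (G ⧸ H)) ≅ stUnit k (gset G (G ⧸ H))) := by
  rw [← toSkeleton_res_eq_one_iff, ← h]
  exact Units.ext_iff

theorem exists_endotrivialKer_hom (k : Type u) [Field k] (H : Subgroup G) :
    ∃ Φ : Additive (EndotrivialKer k H) →+ CechH (Gm G k) (orbitCover H) 1,
      ∀ (t : EndotrivialKer k H) (V : FDRep k G),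
        (t : EndotrivialGroup k G).val = toSkeleton ((toStab _).obj V) →
        ∀ f : stConst k V (gset G (G ⧸ H)) ≅ stUnit k (gset G (G ⧸ H)),
          ∃ hf : cechD (Gm G k) (orbitCover H) 1 (gluing (orbitCover H) f) = 0,
            Φ (Additive.ofMul t) = CechH.mk (gluing (orbitCover H) f) hf := by
  choose V hV using fun t : EndotrivialKer k H =>
    exists_toSkeleton_eq (t : EndotrivialGroup k G).val
  have f : ∀ t, stConst k (V t) (gset G (G ⧸ H)) ≅ stUnit k (gset G (G ⧸ H)) := fun t =>
    ((mem_endotrivialKer_iff (hV t)).mp t.2).some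
  let φ : EndotrivialKer k H → CechH (Gm G k) (orbitCover H) 1 := fun t =>
    CechH.mk (gluing (orbitCover H) (f t)) (cechD_gluing _ _)
  have hφ : ∀ (t : EndotrivialKer k H) (W : FDRep k G),
      (t : EndotrivialGroup k G).val = toSkeleton ((toStab _).obj W) →
      ∀ f' : stConst k W (gset G (G ⧸ H)) ≅ stUnit k (gset G (G ⧸ H)),
        φ t = CechH.mk (gluing (orbitCover H) f') (cechD_gluing _ _) := fun t W hW f' => by
    refine (cechH_mk_eq_iff _ _).mpr (gluing_sub_gluing_mem _ (Nonempty.some ?_) _ _)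
    exact toSkeleton_eq_toSkeleton_iff.mp ((hV t).symm.trans hW)
  refine ⟨AddMonoidHom.mk' (fun t => φ t.toMul) fun s t => ?_, fun t W hW f' =>
    ⟨cechD_gluing _ _, hφ t W hW f'⟩⟩
  obtain ⟨f', hf'⟩ := exists_gluing_tensor (orbitCover H) (f s.toMul) (f t.toMul)
  refine (hφ (s.toMul * t.toMul) (V s.toMul ⊗ V t.toMul) ?_ f').trans ?_
  · rw [toSkeleton_tensor, ← hV, ← hV]
    rfl
  · exact ((cechH_mk_eq_iff _ (by rw [← hf']; exact cechD_gluing _ _)).mpr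
      (by rw [hf', sub_self]; exact zero_mem _)).trans
      (cechH_mk_add (cechD_gluing _ _) (cechD_gluing _ _))

theorem toSkeleton_eq_one_of_gluing_mem (hH : (Nat.card (G ⧸ H) : k) ≠ 0) {V : FDRep k G}
    {f : stConst k V (gset G (G ⧸ H)) ≅ stUnit k (gset G (G ⧸ H))}
    (hf : gluing (orbitCover H) f ∈ (cechD (Gm G k) (orbitCover H) 0).range) :
    toSkeleton ((toStab (FDRep k G)).obj V) = 1 := by
  exact toSkeleton_eq_toSkeleton_iff.mpr (nonempty_iso_of_gluing_mem (orbitCover_hom_eq H) hH hf)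

theorem exists_endotrivialKer_gluing_eq (hH : (Nat.card (G ⧸ H) : k) ≠ 0)
    {z : (Gm G k).obj (op (fibPow (orbitCover H) 2))}
    (hz : cechD (Gm G k) (orbitCover H) 1 z = 0) :
    ∃ (t : EndotrivialKer k H) (V : FDRep k G)
      (f : stConst k V (gset G (G ⧸ H)) ≅ stUnit k (gset G (G ⧸ H))),
      (t : EndotrivialGroup k G).val = toSkeleton ((toStab _).obj V) ∧
        gluing (orbitCover H) f = z := by
  obtain ⟨V, f, hf⟩ := exists_gluing_eq (orbitCover_hom_eq H) hH hz
  obtain ⟨V', f', hf'⟩ := exists_gluing_eq (orbitCover_hom_eq H) hH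
    (show cechD (Gm G k) (orbitCover H) 1 (-z) = 0 by rw [map_neg, hz, neg_zero])
  obtain ⟨e, he⟩ := exists_gluing_tensor (orbitCover H) f f'
  obtain ⟨e', he'⟩ := exists_gluing_tensor (orbitCover H) f' f
  have val_inv := toSkeleton_eq_one_of_gluing_mem hH (f := e)
    (by rw [he, hf, hf', add_neg_cancel]; exact zero_mem _)
  have inv_val := toSkeleton_eq_one_of_gluing_mem hH (f := e')
    (by rw [he', hf, hf', neg_add_cancel]; exact zero_mem _)
  rw [toSkeleton_tensor] at val_inv inv_val
  let t : EndotrivialGroup k G := ⟨_, _, val_inv, inv_val⟩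
  exact ⟨⟨t, (mem_endotrivialKer_iff (t := t) rfl).mpr ⟨f⟩⟩, V, f, rfl, hf⟩

theorem existsUnique_endotrivialKer_addEquiv (hH : (Nat.card (G ⧸ H) : k) ≠ 0) :
    ∃! Φ : Additive (EndotrivialKer k H) ≃+ CechH (Gm G k) (orbitCover H) 1,
      ∀ (t : EndotrivialKer k H) (V : FDRep k G),
        (t : EndotrivialGroup k G).val = toSkeleton ((toStab _).obj V) →
        Nonempty (stConst k V (gset G (G ⧸ H)) ≅ stUnit k (gset G (G ⧸ H))) ∧
        ∀ f : stConst k V (gset G (G ⧸ H)) ≅ stUnit k (gset G (G ⧸ H)),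
          ∃ hf : cechD (Gm G k) (orbitCover H) 1 (gluing (orbitCover H) f) = 0,
            Φ (Additive.ofMul t) = CechH.mk (gluing (orbitCover H) f) hf := by
  obtain ⟨Φ, hΦ⟩ := exists_endotrivialKer_hom k H
  have hinj : Function.Injective Φ := (injective_iff_map_eq_zero Φ).mpr fun t ht => by
    obtain ⟨V, hV⟩ := exists_toSkeleton_eq (t.toMul : EndotrivialGroup k G).val
    obtain ⟨f⟩ := (mem_endotrivialKer_iff hV).mp t.toMul.2
    obtain ⟨hf, h⟩ := hΦ t.toMul V hV f
    have hmem := (cechH_mk_eq_iff hf (map_zero _)).mp (h.symm.trans ht)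
    rw [sub_zero] at hmem
    exact congrArg Additive.ofMul (Subtype.ext (Units.ext
      (hV.trans (toSkeleton_eq_one_of_gluing_mem hH hmem))))
  have hsurj : Function.Surjective Φ := fun c => by
    obtain ⟨⟨z, hz⟩, rfl⟩ := QuotientAddGroup.mk_surjective c
    obtain ⟨t, V, f, hV, rfl⟩ := exists_endotrivialKer_gluing_eq hH hz
    exact ⟨Additive.ofMul t, (hΦ t V hV f).choose_spec⟩
  refine ⟨AddEquiv.ofBijective Φ ⟨hinj, hsurj⟩, fun t V hV =>
    ⟨(mem_endotrivialKer_iff hV).mp t.2, hΦ t V hV⟩, fun Ψ hΨ => AddEquiv.ext fun t => ?_⟩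
  obtain ⟨V, hV⟩ := exists_toSkeleton_eq (t.toMul : EndotrivialGroup k G).val
  obtain ⟨⟨f⟩, h⟩ := hΨ t.toMul V hV
  exact (h f).choose_spec.trans (hΦ t.toMul V hV f).choose_spec.symm

end EndotrivialKer

end SippCech

theorem mainTheorem5 (p : ℕ) [Fact p.Prime] (k : Type u) [Field k] [CharP k p]
    (G : Type v) [Group G] [Finite G]
    (H : Subgroup G) (hH : H.index.Coprime p) :
    IsSippCover p (orbitCover H) ∧
    (∃ θ : constSheaf G p (Additive kˣ) ≅ Gm G k,
      ∀ (X : GSet G) (c : POrbits p X → Additive kˣ) (a : Aut (unitRep k X)),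
        (∀ (x : X.V) (hx : p ∣ Nat.card (MulAction.stabilizer G x)) (t : k),
          (a.hom.app ((ActionCategory.objEquiv G X.V) x)).hom t =
            ((c (pOrbit x hx)).toMul : k) * t) →
        (θ.hom.app (op X)).hom c = Additive.ofMul ((toStab _).mapIso a)) ∧
    ∃! Φ : Additive (EndotrivialKer k H) ≃+ CechH (Gm G k) (orbitCover H) 1,
      ∀ (t : EndotrivialKer k H) (V : FDRep k G),
        (t : EndotrivialGroup k G).val = toSkeleton ((toStab _).obj V) →
        Nonempty (stConst k V (gset G (G ⧸ H)) ≅ stUnit k (gset G (G ⧸ H))) ∧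
        ∀ f : stConst k V (gset G (G ⧸ H)) ≅ stUnit k (gset G (G ⧸ H)),
          ∃ hf : cechD (Gm G k) (orbitCover H) 1 (gluing (orbitCover H) f) = 0,
            Φ (Additive.ofMul t) = CechH.mk (gluing (orbitCover H) f) hf := by
  have hk : (Nat.card (G ⧸ H) : k) ≠ 0 := cast_card_quotient_ne_zero H k hH
  exact ⟨isSippCover_orbitCover H hH, exists_constSheaf_iso p,
    existsUnique_endotrivialKer_addEquiv hk⟩
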